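/- **Block MDPs.** A block MDP $M$ consists of a horizon $H$, latent states $\mathcal S$, emissions $\mathcal X$, actions $\mathcal A$ (finite sets), an initial distribution $\tilde P_0\in\Delta(\mathcal S)$, latent transitions $\tilde P_h(\cdot\mid s,a)\in\Delta(\mathcal S)$, emission distributions $\tilde O_h(\cdot\mid s)\in\Delta(\mathcal X)$, mean rewards $\tilde r_h(s,a)\in[0,1]$ ($1\le h\le H$) and a decoding function $\phi^\star:\mathcal X\to\mathcal S$ such that $\phi^\star(x)=s$ with probability $1$ over $x\sim\tilde O_h(\cdot\mid s)$, for all $h,s$. A policy $\pi$ maps each history $(x_{1:h},a_{1:h-1},r_{1:h-1})$ to a distribution over $\mathcal A$; playing it in $M$ gives a random trajectory $(s_h,x_h,a_h,r_h)_{h\le H}$ with binary rewards $r_h\sim\mathrm{Ber}(\tilde r_h(s_h,a_h))$, whose law is written $\mathbb P^{M,\pi}$. Let $d_h^{M,\pi}$ be the law of $s_h$, and let the value of $\pi$ be $\mathbb E^{M,\pi}[\sum_h r_h]$; $\pi$ has suboptimality at most $\delta$ if its value is at least that of every other policy minus $\delta$. $M$ satisfies *open-loop indistinguishability* if for each $h$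 the law $d_h^{M,\pi}$ is the same for all policies $\pi$ that play a fixed action sequence. A block MDP family indexed by $n\ge 1$ gives, for each $n$, sets $\mathcal S_n,\mathcal A_n$, positive integers $H_n,\ell_n$, a class $\Phi_n$ of functions $\{0,1\}^{\ell_n}\to\mathcal S_n$, and a set $\mathcal M_n$ of block MDPs with horizon $H_n$, latent states $\mathcal S_n$, emissions $\{0,1\}^{\ell_n}$, actions $\mathcal A_n$ and decoding function in $\Phi_n$. **Oracles and reductions.** A *sampling oracle* for $M$, given a policy $\pi$, returns a fresh $(x_{1:H},a_{1:H},r_{1:H})\sim\mathbb P^{M,\pi}$. A *regression oracle*, given a policy $\pi$, a labeling function $L:(\mathcal X\times\mathcal A\times\{0,1\})^H\to\Delta(\{0,1\})\cong[0,1]$ and a step $h$, returns a (circuit-computable) function $R:\mathcal X\to[0,1]$. It is nondeterministic: its answer may depend arbitrarily on the earlier calls and answers. It is *$\varepsilon$-accurate for $M$* if every answer satisfies $$\mathbb E_{s,\,x,\,y}\big[(R(x)-y)^2\big]\le \varepsilon+\mathbb E_{s,\,y}\big[(f(s)-y)^2\big],\qquad s\sim d_h^{M,\pi},\ x\sim\tilde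 O_h(\cdot\mid s),\ y\sim\mathrm{Ber}(f(s)),$$ where $f(s)=\mathbb E^{M,\pi}[L(x_{1:H},a_{1:H},r_{1:H})\mid \phi^\star(x_h)=s]$. For $T:\mathbb N_{\ge1}\to\mathbb N$ and $\varepsilon:\mathbb N_{\ge1}\to(0,1)$, a *$(T,\varepsilon)$-reduction from RL to regression* for a family is a randomized oracle algorithm $\mathrm{Alg}$, with no restriction on its computation, such that for all $n$, all $M\in\mathcal M_n$ and all regression oracles that are $\varepsilon(n)$-accurate for $M$, $\mathrm{Alg}(n)$ makes at most $T(n)$ oracle calls (sampling and regression together), and with probability at least $1/2$ outputs a policy with suboptimality at most $1/2$ in $M$. **The family.** Let $H_n=n$, $N_n=2^n$, $\ell_n=5n$ (so $2^{\ell_n}=N_n^5$), $\mathcal A_n=\{0,1\}$, $\mathcal S_n=([n]\times\{0,1,2\})\cup\{\perp\}$, and let $\Phi_n$ be the set of all functions $\{0,1\}^{\ell_n}\to\mathcal S_n$. The initial latent state is uniform on $\{(1,0),(1,1)\}$. For $h<n$ and $a\in\{0,1\}$, action $a$ leads from $(h,a)$ to a uniformly random element of $\{(h+1,0),(h+1,1)\}$,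 and from $(h,1-a)$ or $(h,2)$ to $(h+1,2)$; $\perp$ is unreachable and absorbing. The reward is $1$ at $(n,0)$ and $(n,1)$ and $0$ at all other states. For $\phi\in\Phi_n$ that attains every value in $\mathcal S_n$, let $M^\phi$ be the block MDP with this latent structure, decoding function $\phi$ and emission distributions $\tilde O_h(\cdot\mid s)=\mathrm{Unif}(\phi^{-1}(s))$, and let $\mathcal M_n$ be the set of all these $M^\phi$. **Theorem.** This is a block MDP family, $\max\{|\mathcal S_n|,|\mathcal A_n|,\ell_n\}\le O(H_n)$, and every $M\in\mathcal M_n$ satisfies open-loop indistinguishability. Moreover there are constants $C>0$ and $C'$ such that for all $T:\mathbb N_{\ge1}\to\mathbb N$ and $\varepsilon:\mathbb N_{\ge1}\to(0,1)$: if there is a $(T,\varepsilon)$-reduction from RL to regression for this family, then for every $n\ge C'$, $$\varepsilon(n)\le C\cdot 2^{-H_n/8}\qquad\text{or}\qquad T(n)\ge C^{-1}\cdot 2^{H_n/8}.$$ -/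

import Mathlib

noncomputable section

namespace BlockRL

open scoped ENNReal

/-- Expectation of a real function under a distribution on a finite type. -/
def expect {α : Type} [Fintype α] (p : PMF α) (g : α → ℝ) : ℝ :=
  ∑ a, (p a).toReal * g a

/-- The Bernoulli distribution with parameter `p ∈ [0,1]`. -/
def coin (p : unitInterval) : PMF Bool :=
  PMF.ofFintype (fun b => cond b (ENNReal.ofReal p) (ENNReal.ofReal (1 - p))) (by
    rw [Fintype.sum_bool]
    simp only [cond_true, cond_false]
    rw [← ENNReal.ofReal_add p.2.1 (by linarith [p.2.2])]
    simp)

/-! ### Block MDPs, policies, trajectories -/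

/-- A block MDP with horizon `H`, latent states `S`, emissions `X` and actions `A`.
Steps are numbered `0, …, H - 1`. The transition attached to the last step is never used. -/
structure BlockMDP (H : ℕ) (S X A : Type) where
  /-- latent initial distribution -/
  init : PMF S
  /-- latent transition distributions -/
  trans : Fin H → S → A → PMF S
  /-- emission distributions -/
  emit : Fin H → S → PMF X
  /-- mean latent rewards -/
  reward : Fin H → S → A → unitInterval
  /-- decoding function -/
  decode : X → S
  /-- an emission of `s` decodes to `s` with probability one -/
  decode_emit : ∀ h s, ∀ x ∈ (emit h s).support, decode x = s

/-- What the learner sees of one step: emission, action, binary reward. -/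
abbrev Obs (X A : Type) : Type := X × A × Bool

/-- One full step of a trajectory: latent state, emission, action, binary reward. -/
abbrev Step (S X A : Type) : Type := S × Obs X A

/-- A (randomized, general) policy: at step `h`, a map from the history
`(x, a, r)_{g < h}`, `x_h` to distributions over actions. -/
abbrev Policy (H : ℕ) (X A : Type) : Type :=
  (h : Fin H) → (Fin h → Obs X A) → X → PMF A

/-- The policy that plays a fixed action sequence. -/
def openLoop {H : ℕ} {X A : Type} (a : Fin H → A) : Policy H X A :=
  fun h _ _ => PMF.pure (a h)

/-- A (randomized) labeling function `(X × A × {0,1})^H → Δ({0,1})`; a distribution on `{0,1}` is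
identified with the probability of the label `1`. -/
abbrev Label (H : ℕ) (X A : Type) : Type := (Fin H → Obs X A) → unitInterval

namespace BlockMDP

variable {H : ℕ} {S X A : Type}

/-- Law of the latent state of step `k`, given the first `k` steps. -/
def nextState (M : BlockMDP H S X A) : (k : ℕ) → k < H → (Fin k → Step S X A) → PMF S
  | 0, _, _ => M.init
  | k + 1, hk, τ =>
      M.trans ⟨k, Nat.lt_of_succ_lt hk⟩ (τ (Fin.last k)).1 (τ (Fin.last k)).2.2.1

/-- Law of the first `k` steps of a trajectory when `π` is played in `M`. -/
def prefixLaw (M : BlockMDP H S X A) (π : Policy H X A) :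
    (k : ℕ) → k ≤ H → PMF (Fin k → Step S X A)
  | 0, _ => PMF.pure Fin.elim0
  | k + 1, hk =>
      (prefixLaw M π k (Nat.le_of_succ_le hk)).bind fun τ =>
      (M.nextState k hk τ).bind fun s =>
      (M.emit ⟨k, hk⟩ s).bind fun x =>
      (π ⟨k, hk⟩ (fun g => (τ g).2) x).bind fun a =>
      (coin (M.reward ⟨k, hk⟩ s a)).map fun r =>
        Fin.snoc (α := fun _ => Step S X A) τ (s, x, a, r)

/-- Law of the trajectory `(s_h, x_h, a_h, r_h)_h` when `π` is played in `M`. -/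
def trajLaw (M : BlockMDP H S X A) (π : Policy H X A) : PMF (Fin H → Step S X A) :=
  M.prefixLaw π H le_rfl

/-- Law of the observed part `(x_h, a_h, r_h)_h` of the trajectory. -/
def obsLaw (M : BlockMDP H S X A) (π : Policy H X A) : PMF (Fin H → Obs X A) :=
  (M.trajLaw π).map fun τ h => (τ h).2

/-- State visitation distribution of step `h`. -/
def visit (M : BlockMDP H S X A) (π : Policy H X A) (h : Fin H) : PMF S :=
  (M.trajLaw π).map fun τ => (τ h).1

/-- Open-loop indistinguishability of the latent MDP: all fixed action sequences induce the same
latent state visitation distribution at every step. -/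
def OpenLoopIndist (M : BlockMDP H S X A) : Prop :=
  ∀ (h : Fin H) (a a' : Fin H → A), M.visit (openLoop a) h = M.visit (openLoop a') h

variable [Fintype S] [Fintype X] [Fintype A]

/-- Expected total reward of `π`. -/
def value (M : BlockMDP H S X A) (π : Policy H X A) : ℝ :=
  expect (M.trajLaw π) fun τ => ∑ h, if (τ h).2.2.2 then 1 else 0

/-- `π` has suboptimality at most `δ`. -/
def Suboptimal (M : BlockMDP H S X A) (δ : ℝ) (π : Policy H X A) : Prop :=
  ∀ π' : Policy H X A, M.value π' ≤ M.value π + δ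

/-- `f(s) = E^{M,π}[L(x, a, r) | φ(x_h) = s]` (equal to `0` where the condition has
probability zero). -/
def labelMean [DecidableEq S] (M : BlockMDP H S X A) (π : Policy H X A) (L : Label H X A)
    (h : Fin H) (s : S) : ℝ :=
  (expect (M.trajLaw π) fun τ =>
      if M.decode (τ h).2.1 = s then (L (fun g => (τ g).2) : ℝ) else 0) /
    (expect (M.trajLaw π) fun τ => if M.decode (τ h).2.1 = s then 1 else 0)

end BlockMDP

/-! ### Oracles -/

/-- The square loss `E_{y ∼ Ber(p)} (v - y)²`. -/
def berLoss (p v : ℝ) : ℝ := p * (v - 1) ^ 2 + (1 - p) * (v - 0) ^ 2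

/-- What a circuit describing a map `X → [0,1]` computes: for some number of output bits, each
emission is assigned a dyadic rational in `[0,1]`. (Each such map is computed by some circuit, as
`X` will be a set of bit strings and circuit sizes are unrestricted.) -/
structure Predictor (X : Type) where
  /-- number of bits after the binary point -/
  bits : ℕ
  /-- numerator of the output -/
  num : X → Fin (2 ^ bits + 1)

/-- The map `X → [0,1]` described by the predictor. -/
def Predictor.eval {X : Type} (R : Predictor X) (x : X) : ℝ := (R.num x : ℕ) / (2 : ℝ) ^ R.bits

/-- `R` is a `(β, f, ε)`-predictor with respect to `D`: the square loss of `R` on `s ∼ β`,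
`x ∼ D(s)`, `y ∼ Ber(f(s))` exceeds that of `f(s)` by at most `ε`. -/
def Predictor.IsAccurate {S X : Type} [Fintype S] [Fintype X] (R : Predictor X)
    (D : S → PMF X) (β : PMF S) (f : S → ℝ) (ε : ℝ) : Prop :=
  (expect β fun s => expect (D s) fun x => berLoss (f s) (R.eval x)) ≤
    ε + expect β fun s => berLoss (f s) (f s)

/-- One completed oracle call: a sampling call with the trajectory it returned, or a regression call
with the predictor it returned. -/
inductive Exchange (H : ℕ) (X A : Type) : Type
  | sample (π : Policy H X A) (o : Fin H → Obs X A)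
  | regress (π : Policy H X A) (L : Label H X A) (h : Fin H) (R : Predictor X)

/-- A nondeterministic regression oracle, through its possible behaviours: its answer to a query
`(π, L, h)` may depend in any way on the earlier exchanges, so that equal queries may
get different answers. -/
abbrev RegOracle (H : ℕ) (X A : Type) : Type :=
  List (Exchange H X A) → Policy H X A → Label H X A → Fin H → Predictor X

/-- The regression oracle is `ε`-accurate for `M`. -/
def RegOracle.IsAccurate {H : ℕ} {S X A : Type} [Fintype S] [DecidableEq S] [Fintype X]
    [Fintype A] (O : RegOracle H X A) (M : BlockMDP H S X A) (ε : ℝ) : Prop :=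
  ∀ t π L h, (O t π L h).IsAccurate (M.emit h) (M.visit π h) (M.labelMean π L h) ε

/-! ### Oracle algorithms -/

/-- The next move of an oracle algorithm. -/
inductive Move (H : ℕ) (X A : Type) : Type
  | sample (π : Policy H X A)
  | regress (π : Policy H X A) (L : Label H X A) (h : Fin H)
  | output (π : Policy H X A)

/-- A randomized oracle algorithm without computational restrictions: the distribution of its next
move, given the exchanges so far. This includes every randomized oracle Turing machine whose
queries and output are circuits. -/
abbrev OracleAlg (H : ℕ) (X A : Type) : Type := List (Exchange H X A) → PMF (Move H X A)

/-- The output of the algorithm `alg`, when its sampling calls are answered by fresh trajectories of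
`M` and its regression calls by `O`, and when at most `k` more calls are allowed after the
exchanges `t`; it is `none` if the algorithm attempts a further call. -/
def run {H : ℕ} {S X A : Type} (M : BlockMDP H S X A) (O : RegOracle H X A)
    (alg : OracleAlg H X A) : (k : ℕ) → (t : List (Exchange H X A)) → PMF (Option (Policy H X A))
  | 0, t => (alg t).bind fun m =>
      match m with
      | .output π => PMF.pure (some π)
      | .sample _ => PMF.pure none
      | .regress _ _ _ => PMF.pure none
  | k + 1, t => (alg t).bind fun m =>
      match m with
      | .output π => PMF.pure (some π)
      | .sample π => (M.obsLaw π).bind fun o => run M O alg k (t ++ [.sample π o])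
      | .regress π L h => run M O alg k (t ++ [.regress π L h (O t π L h)])

/-! ### Families and reductions -/

/-- A block MDP family indexed by a positive integer `n`. -/
structure BlockMDPFamily where
  /-- latent state spaces -/
  S : ℕ+ → Type
  /-- action spaces -/
  A : ℕ+ → Type
  [fintypeS : ∀ n, Fintype (S n)]
  [decEqS : ∀ n, DecidableEq (S n)]
  [fintypeA : ∀ n, Fintype (A n)]
  /-- horizons -/
  H : ℕ+ → ℕ
  H_pos : ∀ n, 0 < H n
  /-- emission lengths -/
  len : ℕ+ → ℕ
  len_pos : ∀ n, 0 < len n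
  /-- decoding function classes -/
  Φ : ∀ n, Set ((Fin (len n) → Bool) → S n)
  /-- the block MDPs of size `n` -/
  mdps : ∀ n, Set (BlockMDP (H n) (S n) (Fin (len n) → Bool) (A n))
  decodable : ∀ n, ∀ M ∈ mdps n, M.decode ∈ Φ n

attribute [instance] BlockMDPFamily.fintypeS BlockMDPFamily.decEqS BlockMDPFamily.fintypeA

/-- The emission space `{0,1}^{ℓ_n}`. -/
abbrev BlockMDPFamily.X (F : BlockMDPFamily) (n : ℕ+) : Type := Fin (F.len n) → Bool

/-- `alg` is a `(T, ε)`-reduction from RL to regression for the family `F`: for every block MDP of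
the family and every `ε(n)`-accurate regression oracle, it makes at most `T(n)` oracle calls, and
with probability at least `1/2` its output has suboptimality at most `1/2`. -/
def IsReduction (F : BlockMDPFamily) (T : ℕ+ → ℕ) (ε : ℕ+ → ℝ)
    (alg : ∀ n, OracleAlg (F.H n) (F.X n) (F.A n)) : Prop :=
  ∀ n, ∀ M ∈ F.mdps n, ∀ O : RegOracle (F.H n) (F.X n) (F.A n), O.IsAccurate M (ε n) →
    none ∉ (run M O (alg n) (T n) []).support ∧
    (1 / 2 : ℝ≥0∞) ≤ (run M O (alg n) (T n) []).toOuterMeasure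
      {out | ∃ π, out = some π ∧ M.Suboptimal (1 / 2) π}

/-! ### The family of block MDPs -/

/-- Latent states: `some (h, b)` with `b ∈ {0,1,2}` at step `h`, and the unreachable `⊥ = none`. -/
abbrev LockState (H : ℕ) : Type := Option (Fin H × Fin 3)

/-- Latent transitions. In state `(h, b)` with `b ∈ {0,1}`, playing `b` leads to a uniformly random
one of `(h + 1, 0)` and `(h + 1, 1)`; otherwise the next state is `(h + 1, 2)`. The state `⊥` is
absorbing, and transitions out of the last layer (never used) go to `⊥`. -/
def lockTrans (H : ℕ) : LockState H → Fin 2 → PMF (LockState H)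
  | none, _ => PMF.pure none
  | some (g, b), a =>
      if hg : (g : ℕ) + 1 < H then
        if b = a.castSucc then
          (PMF.uniformOfFintype (Fin 2)).map fun c => some (⟨g + 1, hg⟩, c.castSucc)
        else PMF.pure (some (⟨g + 1, hg⟩, 2))
      else PMF.pure none

/-- Rewards: `1` at the states `(h, 0)`, `(h, 1)` of the last step, and `0` elsewhere. -/
def lockReward (H : ℕ) : LockState H → unitInterval
  | none => 0
  | some (g, b) => if (g : ℕ) + 1 = H ∧ b ≠ 2 then 1 else 0

/-- The block MDP of the decoding function `φ`: the emission of a state `s` is uniform on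
the preimage of `s` under `φ`, which has to be nonempty for each `s`. -/
def lockMDP (H : ℕ) (hH : 0 < H) {X : Type} [Fintype X] (φ : X → LockState H)
    (hφ : Function.Surjective φ) : BlockMDP H (LockState H) X (Fin 2) where
  init := (PMF.uniformOfFintype (Fin 2)).map fun c => some (⟨0, hH⟩, c.castSucc)
  trans _ := lockTrans H
  emit _ s := PMF.uniformOfFinset (Finset.univ.filter fun x => φ x = s)
    (by obtain ⟨x, hx⟩ := hφ s; exact ⟨x, by simp [hx]⟩)
  reward _ s _ := lockReward H s
  decode := φ
  decode_emit := by
    intro h s x hx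
    rw [PMF.mem_support_uniformOfFinset_iff] at hx
    simpa using hx

/-- The family: `H_n = n`, `N_n = 2 ^ n`, and `2 ^ ℓ_n` is the least power of two that is at least
`N_n ^ 5`, so `ℓ_n = 5 n`. The decoding functions are all functions from `{0,1}^{ℓ_n}` to the
latent states, and there is one block MDP for each of them whose emission distributions
are defined, that is, which attains every latent state. -/
def lockFamily : BlockMDPFamily where
  S n := LockState n
  A _ := Fin 2
  H n := n
  H_pos n := n.pos
  len n := 5 * n
  len_pos n := Nat.mul_pos (by norm_num) n.pos
  Φ _ := Set.univ
  mdps n := {M | ∃ (φ : (Fin (5 * n) → Bool) → LockState n) (hφ : Function.Surjective φ),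
    M = lockMDP n n.pos φ hφ}
  decodable _ _ _ := Set.mem_univ _

end BlockRL

end

noncomputable section

set_option linter.unusedSectionVars false

namespace BlockRL

open scoped ENNReal

/-! ### Laws of sequences -/

/-! The lower bound averages over random decoding functions. Emissions are split into `2 ^ (4 * n)`
blocks, each a copy of `ZMod (2 ^ n)` with a fixed labeling by latent states, and block `i` is
shifted by a uniformly random `θ i`. Shifts preserve fiber sizes, so the probability of a trajectory
is the same for all `θ` consistent with it. Thus a trajectory only informs about the shifts of the
at most `H` blocks it visits, and the knowledge gained so far is an event `E` determined by a small
set `T` of coordinates. Averaged over `E`, a reward-free trajectory whose emissions lie in distinct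
blocks outside `T` has exactly its probability under an ideal law: emissions are independent and
uniform, and the latent states run on their own given the actions (`sum_trajLaw_mdp_of_isGood`). All
other trajectories together have mass at most `defect`, of order `2 ^ (-n)` as long as `T` is not
too large. This has two consequences. A fixed policy earns almost nothing on average, while the
policy that knows `θ` earns 1. And regression is useless: by open-loop indistinguishability the
label is independent of `s_h` under the ideal law, so `E[(L - v) 1(s_h = s)]` has small mean over
`θ` when `v` is near the ideal mean of the label. Conditioning on one trajectory bounds its second
moment in the same way (`sum_centered_sq_le`), so the constant `v` is an accurate answer for most
`θ`. Induction on the calls (`sum_run_le`) bounds the average success probability by a term of order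
`n * defect` plus the number of calls times `n * 2 ^ (-n/2) / ε`, which is less than `1/2` if both
alternatives of the conclusion fail. Open-loop indistinguishability of the lock holds because either
action keeps exactly one of the two rewarding branches alive, with half of their mass
(`IsLayerLaw.bind_lockTrans`). -/

theorem bind_map_apply_of_injective2 {α β γ : Type} (p : PMF α) (q : α → PMF β) {f : α → β → γ}
    (hf : Function.Injective2 f) (a : α) (b : β) :
    (p.bind fun a => (q a).map (f a)) (f a b) = p a * q a b := by
  rw [PMF.bind_apply, tsum_eq_single a]
  · rw [PMF.map_apply, tsum_eq_single b]
    · simp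
    · intro b' hb'
      rw [if_neg]
      intro h
      exact hb' (hf h).2.symm
  · intro a' ha'
    rw [PMF.map_apply, ENNReal.tsum_eq_zero.2, mul_zero]
    intro b'
    rw [if_neg]
    intro h
    exact ha' (hf h).1.symm

/-- The law of a sequence whose entries are drawn one after the other, the entry of index `k` from
the kernel `κ k` applied to the earlier entries. -/
def seqLaw {H : ℕ} {α : Type} (κ : (k : ℕ) → k < H → (Fin k → α) → PMF α) :
    (k : ℕ) → k ≤ H → PMF (Fin k → α)
  | 0, _ => PMF.pure Fin.elim0
  | k + 1, hk => (seqLaw κ k (Nat.le_of_succ_le hk)).bind fun τ =>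
      (κ k hk τ).map fun a => Fin.snoc (α := fun _ => α) τ a

theorem snoc_injective2 {k : ℕ} {α : Type} :
    Function.Injective2 (fun (τ : Fin k → α) (a : α) => Fin.snoc (α := fun _ => α) τ a) :=
  fun _ _ _ _ h => Fin.snoc_inj.1 h

theorem seqLaw_apply {H : ℕ} {α : Type} (κ : (k : ℕ) → k < H → (Fin k → α) → PMF α) (k : ℕ)
    (hk : k ≤ H) (τ : Fin k → α) :
    seqLaw κ k hk τ =
      ∏ g : Fin k, κ g (g.2.trans_le hk) (fun i => τ (i.castLE g.2.le)) (τ g) := by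
  induction k with
  | zero =>
    simp [seqLaw, PMF.pure_apply]
    exact Subsingleton.elim _ _
  | succ k ih =>
    obtain ⟨τ, a, rfl⟩ : ∃ (τ' : Fin k → α) (a : α), τ = Fin.snoc (α := fun _ => α) τ' a :=
      ⟨Fin.init τ, τ (Fin.last k), (Fin.snoc_init_self (α := fun _ => α) τ).symm⟩
    rw [seqLaw, bind_map_apply_of_injective2 _ _ snoc_injective2, ih, Fin.prod_univ_castSucc]
    congr 1
    · refine Finset.prod_congr rfl fun g _ => ?_
      rw [Fin.snoc_castSucc]
      congr 2
      funext i
      exact (Fin.snoc_castSucc (α := fun _ => α) a τ (i.castLE g.2.le)).symm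
    · rw [Fin.snoc_last]
      congr 2
      funext i
      exact (Fin.snoc_castSucc (α := fun _ => α) a τ i).symm

theorem seqLaw_succ_map_castSucc {H : ℕ} {α : Type}
    (κ : (k : ℕ) → k < H → (Fin k → α) → PMF α) (k : ℕ) (hk : k + 1 ≤ H) :
    (seqLaw κ (k + 1) hk).map (fun τ i => τ (Fin.castSucc i)) =
      seqLaw κ k (Nat.le_of_succ_le hk) := by
  rw [seqLaw, PMF.map_bind]
  simp only [PMF.map_comp, Function.comp_def, Fin.snoc_castSucc]
  exact (congrArg _ (funext fun τ => PMF.map_const _ _)).trans (PMF.bind_pure _)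

theorem seqLaw_map_castLE {H : ℕ} {α : Type} (κ : (k : ℕ) → k < H → (Fin k → α) → PMF α)
    {k m : ℕ} (hkm : k ≤ m) (hm : m ≤ H) :
    (seqLaw κ m hm).map (fun τ i => τ (Fin.castLE hkm i)) = seqLaw κ k (hkm.trans hm) := by
  induction m, hkm using Nat.le_induction with
  | base => exact PMF.map_id _
  | succ m hkm ih =>
    rw [← ih (Nat.le_of_succ_le hm), ← seqLaw_succ_map_castSucc κ m hm, PMF.map_comp]
    rfl

theorem seqLaw_map_apply {H : ℕ} {α : Type} (κ : (k : ℕ) → k < H → (Fin k → α) → PMF α)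
    (h : Fin H) :
    (seqLaw κ H le_rfl).map (fun τ => τ h) =
      (seqLaw κ (h + 1) h.2).map (fun τ => τ (Fin.last h)) := by
  rw [← seqLaw_map_castLE κ (k := h + 1) (m := H) h.2 le_rfl, PMF.map_comp]
  rfl

theorem seqLaw_succ_map_last {H : ℕ} {α : Type} (κ : (k : ℕ) → k < H → (Fin k → α) → PMF α)
    (k : ℕ) (hk : k + 1 ≤ H) :
    (seqLaw κ (k + 1) hk).map (fun τ => τ (Fin.last k)) =
      (seqLaw κ k (Nat.le_of_succ_le hk)).bind (κ k hk) := by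
  rw [seqLaw, PMF.map_bind]
  simp only [PMF.map_comp, Function.comp_def, Fin.snoc_last]
  exact congrArg _ (funext fun τ => PMF.map_id _)

/-! ### Trajectory probabilities as products. -/

namespace BlockMDP

variable {H : ℕ} {S X A : Type}

/-- The law of one step of a trajectory, given the earlier steps. -/
def stepLaw (M : BlockMDP H S X A) (π : Policy H X A) (k : ℕ) (hk : k < H)
    (τ : Fin k → Step S X A) : PMF (Step S X A) :=
  (M.nextState k hk τ).bind fun s =>
    ((M.emit ⟨k, hk⟩ s).bind fun x =>
      ((π ⟨k, hk⟩ (fun g => (τ g).2) x).bind fun a =>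
        (coin (M.reward ⟨k, hk⟩ s a)).map (Prod.mk a)).map (Prod.mk x)).map (Prod.mk s)

theorem stepLaw_apply (M : BlockMDP H S X A) (π : Policy H X A) (k : ℕ) (hk : k < H)
    (τ : Fin k → Step S X A) (u : Step S X A) :
    M.stepLaw π k hk τ u = M.nextState k hk τ u.1 * (M.emit ⟨k, hk⟩ u.1 u.2.1 *
      (π ⟨k, hk⟩ (fun g => (τ g).2) u.2.1 u.2.2.1 *
        coin (M.reward ⟨k, hk⟩ u.1 u.2.2.1) u.2.2.2)) := by
  obtain ⟨s, x, a, r⟩ := u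
  have inj : ∀ α β : Type, Function.Injective2 (Prod.mk : α → β → α × β) :=
    fun _ _ _ _ _ _ h => Prod.mk.inj h
  rw [stepLaw, bind_map_apply_of_injective2 _ _ (inj _ _), bind_map_apply_of_injective2 _ _ (inj _ _),
    bind_map_apply_of_injective2 _ _ (inj _ _)]

theorem prefixLaw_eq_seqLaw (M : BlockMDP H S X A) (π : Policy H X A) (k : ℕ) (hk : k ≤ H) :
    M.prefixLaw π k hk = seqLaw (M.stepLaw π) k hk := by
  induction k with
  | zero => rfl
  | succ k ih =>
    rw [prefixLaw, seqLaw, ih]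
    simp only [stepLaw, PMF.map_bind, PMF.map_comp]
    rfl

/-- The transition kernel of the latent states when the actions `a` are played. -/
def latentStep (M : BlockMDP H S X A) (a : Fin H → A) :
    (k : ℕ) → k < H → (Fin k → S) → PMF S
  | 0, _, _ => M.init
  | k + 1, hk, s => M.trans ⟨k, Nat.lt_of_succ_lt hk⟩ (s (Fin.last k)) (a ⟨k, Nat.lt_of_succ_lt hk⟩)

/-- The law of the latent states when the actions `a` are played. -/
def latentLaw (M : BlockMDP H S X A) (a : Fin H → A) : PMF (Fin H → S) :=
  seqLaw (M.latentStep a) H le_rfl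

end BlockMDP

/-- The law of the actions of a policy that sees the emissions `x` and the rewards `r`. -/
def actionLaw {H : ℕ} {X A : Type} (π : Policy H X A) (x : Fin H → X) (r : Fin H → Bool) :
    PMF (Fin H → A) :=
  seqLaw (fun k hk a => π ⟨k, hk⟩
    (fun g => (x (g.castLE hk.le), a g, r (g.castLE hk.le))) (x ⟨k, hk⟩)) H le_rfl

namespace BlockMDP

variable {H : ℕ} {S X A : Type}

theorem nextState_eq_latentStep (M : BlockMDP H S X A) (k : ℕ) (hk : k < H)
    (τ : Fin H → Step S X A) :
    M.nextState k hk (fun i => τ (i.castLE hk.le)) =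
      M.latentStep (fun h => (τ h).2.2.1) k hk (fun i => (τ (i.castLE hk.le)).1) := by
  cases k <;> rfl

/-- Regrouping the factors by kind separates the decoding function, which for a lock enters only the
emission factor, from the latent dynamics, the policy and the rewards. -/
theorem trajLaw_apply (M : BlockMDP H S X A) (π : Policy H X A) (τ : Fin H → Step S X A) :
    M.trajLaw π τ = M.latentLaw (fun h => (τ h).2.2.1) (fun h => (τ h).1) *
      ((∏ h, M.emit h (τ h).1 (τ h).2.1) *
      (actionLaw π (fun h => (τ h).2.1) (fun h => (τ h).2.2.2) (fun h => (τ h).2.2.1) *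
        ∏ h, coin (M.reward h (τ h).1 (τ h).2.2.1) (τ h).2.2.2)) := by
  rw [trajLaw, prefixLaw_eq_seqLaw, seqLaw_apply, latentLaw, seqLaw_apply, actionLaw, seqLaw_apply,
    ← Finset.prod_mul_distrib, ← Finset.prod_mul_distrib, ← Finset.prod_mul_distrib]
  refine Finset.prod_congr rfl fun g _ => ?_
  rw [stepLaw_apply, nextState_eq_latentStep]

end BlockMDP

/-! ### Expectations -/

section expect

variable {α β : Type} [Fintype α] [Fintype β]

theorem sum_toReal (p : PMF α) : ∑ a, (p a).toReal = 1 := by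
  rw [← ENNReal.toReal_sum fun a _ => p.apply_ne_top a, ← tsum_fintype (L := .unconditional _),
    p.tsum_coe, ENNReal.toReal_one]

theorem expect_const (p : PMF α) (c : ℝ) : expect p (fun _ => c) = c := by
  rw [expect, ← Finset.sum_mul, sum_toReal, one_mul]

theorem expect_mono (p : PMF α) {f g : α → ℝ} (h : ∀ a ∈ p.support, f a ≤ g a) :
    expect p f ≤ expect p g := by
  refine Finset.sum_le_sum fun a _ => ?_
  by_cases ha : p a = 0
  · simp [ha]
  · exact mul_le_mul_of_nonneg_left (h a ha) ENNReal.toReal_nonneg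

theorem expect_congr (p : PMF α) {f g : α → ℝ} (h : ∀ a ∈ p.support, f a = g a) :
    expect p f = expect p g :=
  le_antisymm (expect_mono p fun a ha => (h a ha).le) (expect_mono p fun a ha => (h a ha).ge)

theorem expect_add (p : PMF α) (f g : α → ℝ) :
    expect p (fun a => f a + g a) = expect p f + expect p g := by
  simp only [expect, mul_add, Finset.sum_add_distrib]

theorem expect_sub (p : PMF α) (f g : α → ℝ) :
    expect p (fun a => f a - g a) = expect p f - expect p g := by
  simp only [expect, mul_sub, Finset.sum_sub_distrib]

theorem expect_mul_const (p : PMF α) (f : α → ℝ) (c : ℝ) :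
    expect p (fun a => f a * c) = expect p f * c := by
  simp only [expect, Finset.sum_mul, mul_assoc]

theorem expect_finset_sum {ι : Type} (p : PMF α) (s : Finset ι) (f : ι → α → ℝ) :
    expect p (fun a => ∑ i ∈ s, f i a) = ∑ i ∈ s, expect p (f i) := by
  simp only [expect, Finset.mul_sum]
  exact Finset.sum_comm

theorem expect_bind (p : PMF α) (q : α → PMF β) (f : β → ℝ) :
    expect (p.bind q) f = expect p fun a => expect (q a) f := by
  simp only [expect, PMF.bind_apply, tsum_fintype, Finset.mul_sum]
  rw [Finset.sum_comm]
  refine Finset.sum_congr rfl fun b _ => ?_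
  rw [ENNReal.toReal_sum fun a _ => ENNReal.mul_ne_top (p.apply_ne_top a) ((q a).apply_ne_top b),
    Finset.sum_mul]
  simp only [ENNReal.toReal_mul, mul_assoc]

theorem expect_pure (a : α) (f : α → ℝ) : expect (PMF.pure a) f = f a := by
  classical
  rw [expect, Finset.sum_eq_single a]
  · simp
  · intro b _ hb
    simp [PMF.pure_apply, hb]
  · simp

theorem expect_map (p : PMF α) (g : α → β) (f : β → ℝ) :
    expect (p.map g) f = expect p fun a => f (g a) := by
  rw [← PMF.bind_pure_comp, expect_bind]
  simp [expect_pure]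

theorem expect_ite_eq [DecidableEq α] (p : PMF α) (a : α) :
    (expect p fun b => if b = a then 1 else 0) = (p a).toReal := by
  simp [expect]

end expect

/-! ### Open-loop policies -/

namespace BlockMDP

variable {H : ℕ} {S X A : Type}

/-- The actions are kept beside the latent states because the pair is what the next transition
reads; emissions and rewards integrate out when the policy ignores them. -/
theorem prefixLaw_openLoop_map (M : BlockMDP H S X A) (a : Fin H → A) (k : ℕ) (hk : k ≤ H) :
    (M.prefixLaw (openLoop a) k hk).map (fun τ i => ((τ i).1, (τ i).2.2.1)) =
      (seqLaw (M.latentStep a) k hk).map (fun s i => (s i, a (i.castLE hk))) := by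
  induction k with
  | zero =>
    simp only [prefixLaw, seqLaw, PMF.pure_map]
    exact congrArg _ (Subsingleton.elim _ _)
  | succ k ih =>
    -- `N` is the next-state kernel read from state-action pairs, so the initial and the later steps
    -- are treated at once.
    obtain ⟨N, hN, hN'⟩ : ∃ N : (Fin k → S × A) → PMF S,
        (∀ τ, M.nextState k hk τ = N fun i => ((τ i).1, (τ i).2.2.1)) ∧
        ∀ s, M.latentStep a k hk s = N fun i => (s i, a (i.castLE (Nat.le_of_succ_le hk))) := by
      cases k with
      | zero => exact ⟨fun _ => M.init, fun _ => rfl, fun _ => rfl⟩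
      | succ k =>
        exact ⟨fun u => M.trans ⟨k, Nat.lt_of_succ_lt hk⟩ (u (Fin.last k)).1 (u (Fin.last k)).2,
          fun _ => rfl, fun _ => rfl⟩
    have key := congrArg (fun p : PMF (Fin k → S × A) => p.bind fun u => (N u).map fun s =>
      Fin.snoc (α := fun _ => S × A) u (s, a ⟨k, hk⟩)) (ih (Nat.le_of_succ_le hk))
    simp only [PMF.bind_map, Function.comp_def] at key
    refine Eq.trans ?_ (key.trans ?_)
    · rw [prefixLaw, PMF.map_bind]
      refine congrArg _ (funext fun τ => ?_)
      rw [PMF.map_bind, hN, ← PMF.bind_pure_comp]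
      refine congrArg _ (funext fun s => ?_)
      simp only [openLoop, PMF.pure_bind, PMF.map_bind, PMF.map_comp]
      rw [Function.comp_apply]
      have : ∀ x : X, ((fun (τ : Fin (k + 1) → Step S X A) i => ((τ i).1, (τ i).2.2.1)) ∘ fun r =>
          Fin.snoc (α := fun _ => Step S X A) τ (s, x, a ⟨k, hk⟩, r)) =
          Function.const Bool (Fin.snoc (α := fun _ => S × A)
            (fun i => ((τ i).1, (τ i).2.2.1)) (s, a ⟨k, hk⟩)) := by
        intro x
        funext r i
        refine Fin.lastCases ?_ (fun i => ?_) i <;> simp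
      simp only [this, PMF.map_const, PMF.bind_const]
    · rw [seqLaw, PMF.map_bind]
      refine congrArg _ (funext fun s => ?_)
      rw [hN', PMF.map_comp]
      refine congrArg (fun f => PMF.map f _) (funext fun t => funext fun i => ?_)
      refine Fin.lastCases ?_ (fun i => ?_) i
      · simp only [Function.comp_apply, Fin.snoc_last]
        rfl
      · simp only [Function.comp_apply, Fin.snoc_castSucc]
        rfl

theorem visit_openLoop (M : BlockMDP H S X A) (a : Fin H → A) (h : Fin H) :
    M.visit (openLoop a) h = (M.latentLaw a).map fun s => s h := by
  have := congrArg (PMF.map fun u => (u h).1) (M.prefixLaw_openLoop_map a H le_rfl)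
  rw [PMF.map_comp, PMF.map_comp] at this
  exact this

end BlockMDP

/-! ### The latent states of the lock -/

/-- A law on the latent states that charges only layer `h`, and that charges each of the states
`(h, 0)` and `(h, 1)` with `2 ^ (- h - 1)`. -/
def IsLayerLaw {H : ℕ} (h : Fin H) (μ : PMF (LockState H)) : Prop :=
  (∀ c : Fin 2, μ (some (h, c.castSucc)) = 2⁻¹ ^ ((h : ℕ) + 1)) ∧
    ∀ s ∈ μ.support, ∃ b, s = some (h, b)

/-- A layer has three states: two masses are prescribed, and total mass 1 forces the third. -/
theorem IsLayerLaw.eq {H : ℕ} {h : Fin H} {μ ν : PMF (LockState H)} (hμ : IsLayerLaw h μ)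
    (hν : IsLayerLaw h ν) : μ = ν := by
  have zero : ∀ {ρ : PMF (LockState H)}, IsLayerLaw h ρ → ∀ s, (∀ b, s ≠ some (h, b)) → ρ s = 0 := by
    intro ρ hρ s hs
    by_contra h0
    obtain ⟨b, hb⟩ := hρ.2 s h0
    exact hs b hb
  have total : ∀ {ρ : PMF (LockState H)}, IsLayerLaw h ρ →
      ρ (some (h, 2)) + (2⁻¹ ^ ((h : ℕ) + 1) + 2⁻¹ ^ ((h : ℕ) + 1)) = 1 := by
    intro ρ hρ
    rw [← ρ.tsum_coe, tsum_eq_sum (s := Finset.univ.image fun b : Fin 3 => some (h, b))]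
    · rw [Finset.sum_image (by intro a _ b _ hab; simpa using hab), Fin.sum_univ_three]
      have h0 := hρ.1 0
      have h1 := hρ.1 1
      simp only [Fin.castSucc_zero, Fin.castSucc_one] at h0 h1
      rw [h0, h1, add_comm]
    · intro s hs
      refine zero hρ s fun b hb => hs ?_
      simp [hb]
  have fin : (2⁻¹ ^ ((h : ℕ) + 1) + 2⁻¹ ^ ((h : ℕ) + 1) : ℝ≥0∞) ≠ ⊤ := by simp
  ext s
  by_cases hs : ∃ b, s = some (h, b)
  · obtain ⟨b, rfl⟩ := hs
    induction b using Fin.lastCases with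
    | last => exact (ENNReal.add_left_inj fin).1 ((total hμ).trans (total hν).symm)
    | cast c => rw [hμ.1, hν.1]
  · push Not at hs
    rw [zero hμ s hs, zero hν s hs]

theorem isLayerLaw_init {H : ℕ} (hH : 0 < H) : IsLayerLaw (⟨0, hH⟩ : Fin H)
    ((PMF.uniformOfFintype (Fin 2)).map fun c => some ((⟨0, hH⟩ : Fin H), c.castSucc)) := by
  refine ⟨fun c => ?_, fun s hs => ?_⟩
  · rw [PMF.map_apply, tsum_eq_single c]
    · simp
    · intro b hb
      rw [if_neg]
      simpa using hb.symm
  · obtain ⟨c, -, rfl⟩ := (PMF.mem_support_map_iff _ _ _).1 hs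
    exact ⟨_, rfl⟩

/-- Whatever `a` is, only the state named by `a` feeds the next two live states, and it splits its
mass evenly, so each gets half of it. -/
theorem IsLayerLaw.bind_lockTrans {H k : ℕ} (hk : k + 1 < H) {μ : PMF (LockState H)}
    (hμ : IsLayerLaw ⟨k, Nat.lt_of_succ_lt hk⟩ μ) (a : Fin 2) :
    IsLayerLaw ⟨k + 1, hk⟩ (μ.bind fun s => lockTrans H s a) := by
  refine ⟨fun c => ?_, fun s hs => ?_⟩
  · rw [PMF.bind_apply, tsum_eq_single (some (⟨k, Nat.lt_of_succ_lt hk⟩, a.castSucc))]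
    · rw [hμ.1, lockTrans, dif_pos hk, if_pos rfl, PMF.map_apply, tsum_eq_single c]
      · simp [pow_succ]
      · intro b hb
        rw [if_neg]
        simpa using hb.symm
    · intro s hs
      by_cases h0 : μ s = 0
      · rw [h0, zero_mul]
      · obtain ⟨b, rfl⟩ := hμ.2 s h0
        rw [lockTrans, dif_pos hk, if_neg (by rintro rfl; exact hs rfl), PMF.pure_apply, if_neg,
          mul_zero]
        intro h
        have := congrArg Prod.snd (Option.some.inj h)
        exact (Fin.castSucc_lt_last c).ne this
  · obtain ⟨s', hs', hs⟩ := (PMF.mem_support_bind_iff _ _ _).1 hs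
    obtain ⟨b, rfl⟩ := hμ.2 s' hs'
    rw [lockTrans, dif_pos hk] at hs
    split_ifs at hs
    · obtain ⟨c, -, rfl⟩ := (PMF.mem_support_map_iff _ _ _).1 hs
      exact ⟨_, rfl⟩
    · rw [PMF.mem_support_pure_iff] at hs
      exact ⟨_, hs⟩

theorem isLayerLaw_latentLaw {H : ℕ} (hH : 0 < H) {X : Type} [Fintype X] (φ : X → LockState H)
    (hφ : Function.Surjective φ) (a : Fin H → Fin 2) (h : Fin H) :
    IsLayerLaw h (((lockMDP H hH φ hφ).latentLaw a).map fun s => s h) := by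
  rw [BlockMDP.latentLaw, seqLaw_map_apply]
  obtain ⟨h, hh⟩ := h
  induction h with
  | zero =>
    have := seqLaw_succ_map_last ((lockMDP H hH φ hφ).latentStep a) 0 hh
    rw [seqLaw, PMF.pure_bind] at this
    exact this ▸ isLayerLaw_init hH
  | succ k ih =>
    have := seqLaw_succ_map_last ((lockMDP H hH φ hφ).latentStep a) (k + 1) hh
    have h2 := (ih (Nat.lt_of_succ_lt hh)).bind_lockTrans hh (a ⟨k, Nat.lt_of_succ_lt hh⟩)
    rw [PMF.bind_map] at h2
    exact this ▸ h2

theorem openLoopIndist_lockMDP {H : ℕ} (hH : 0 < H) {X : Type} [Fintype X] (φ : X → LockState H)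
    (hφ : Function.Surjective φ) : (lockMDP H hH φ hφ).OpenLoopIndist := by
  intro h a a'
  rw [BlockMDP.visit_openLoop, BlockMDP.visit_openLoop]
  exact (isLayerLaw_latentLaw hH φ hφ a h).eq (isLayerLaw_latentLaw hH φ hφ a' h)

/-! ### Random decoding functions -/

theorem BlockMDP.latentStep_congr {H : ℕ} {S X A : Type} {M M' : BlockMDP H S X A}
    (hi : M.init = M'.init) (ht : M.trans = M'.trans) (a : Fin H → A) :
    M.latentStep a = M'.latentStep a := by
  funext k hk s
  cases k <;> simp only [BlockMDP.latentStep, hi, ht]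

/-- Exchanging `d` with `θ i` is an involution of the pairs `(θ, d)`. In probabilistic terms, one
coordinate of a uniform function may be resampled. -/
theorem sum_sum_update {α β : Type} [Fintype α] [DecidableEq α] [Fintype β] {M : Type}
    [AddCommMonoid M] (i : α) (F : (α → β) → M) :
    ∑ θ, ∑ d, F (Function.update θ i d) = Fintype.card β • ∑ θ, F θ := by
  have inv : Function.Involutive
      (fun p : (α → β) × β => (Function.update p.1 i p.2, p.1 i)) := by
    rintro ⟨θ, d⟩
    simp
  calc ∑ θ, ∑ d, F (Function.update θ i d)
      = ∑ p : (α → β) × β, F (Function.update p.1 i p.2) := by rw [Fintype.sum_prod_type]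
    _ = ∑ p : (α → β) × β, F p.1 :=
        Equiv.sum_comp (inv.toPerm _) fun p : (α → β) × β => F p.1
    _ = Fintype.card β • ∑ θ, F θ := by
        rw [Fintype.sum_prod_type, Finset.smul_sum]
        simp

/-- The set `E` of functions depends only on their values on `T`. -/
def Determined {I J : Type} (E : Finset (I → J)) (T : Finset I) : Prop :=
  ∀ θ θ', (∀ i ∈ T, θ i = θ' i) → θ ∈ E → θ' ∈ E

/-- Trajectories of a lock. -/
abbrev Traj (H : ℕ) (X : Type) : Type := Fin H → Step (LockState H) X (Fin 2)

/-- A splitting of the emissions into blocks indexed by `I` and identified with `J`, and a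
labeling of `J` by the latent states. -/
structure Scrambler (H : ℕ) (X I J : Type) where
  /-- the block of an emission and its place in the block -/
  split : X ≃ I × J
  /-- the labeling -/
  label : J → LockState H
  label_surj : Function.Surjective label
  H_pos : 0 < H

namespace Scrambler

section decode

variable {H : ℕ} {X I J : Type} [AddGroup J] (W : Scrambler H X I J)

theorem card_emission {H : ℕ} {X I J : Type} [Fintype X] [Fintype I] [Fintype J]
    (W : Scrambler H X I J) : Fintype.card X = Fintype.card I * Fintype.card J := by
  rw [Fintype.card_congr W.split, Fintype.card_prod]

/-- The block of an emission. -/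
def block (x : X) : I := (W.split x).1

/-- The decoding function which shifts block `i` by `θ i`. -/
def decode (θ : I → J) (x : X) : LockState H := W.label ((W.split x).2 + θ (W.block x))

/-- The decoding function `W.decode θ` is consistent with the trajectory `τ`. -/
def Match (τ : Traj H X) (θ : I → J) : Prop := ∀ h, W.decode θ (τ h).2.1 = (τ h).1

instance (τ : Traj H X) : DecidablePred (W.Match τ) :=
  fun θ => inferInstanceAs (Decidable (∀ h, W.decode θ (τ h).2.1 = (τ h).1))

theorem decode_surj [Nonempty I] (θ : I → J) : Function.Surjective (W.decode θ) := by
  intro s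
  obtain ⟨j, rfl⟩ := W.label_surj s
  obtain ⟨i⟩ := ‹Nonempty I›
  exact ⟨W.split.symm (i, j - θ i), by simp [decode, block]⟩

/-- Conditioning on a trajectory reveals only the shifts of the blocks it visits. -/
theorem determined_filter_match [DecidableEq I] {E : Finset (I → J)} {T : Finset I}
    (hE : Determined E T) (τ : Traj H X) :
    Determined (E.filter (W.Match τ)) (T ∪ Finset.univ.image fun h => W.block (τ h).2.1) := by
  intro θ θ' hθ h
  rw [Finset.mem_filter] at h ⊢
  refine ⟨hE θ θ' (fun i hi => hθ i (Finset.mem_union_left _ hi)) h.1, fun g => ?_⟩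
  rw [← h.2 g, decode, decode, hθ (W.block (τ g).2.1)
    (Finset.mem_union_right _ (Finset.mem_image_of_mem _ (Finset.mem_univ g)))]

end decode

/-! ### Counting the shifts consistent with a trajectory. -/

variable {H : ℕ} {X I J : Type} [Fintype X] [Fintype I] [DecidableEq I] [Fintype J] [AddGroup J]
  (W : Scrambler H X I J)

/-- The number of elements of `J` with a given label. -/
def fiberCard (s : LockState H) : ℕ := (Finset.univ.filter fun j => W.label j = s).card

theorem fiberCard_pos (s : LockState H) : 0 < W.fiberCard s := by
  obtain ⟨j, hj⟩ := W.label_surj s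
  exact Finset.card_pos.2 ⟨j, by simp [hj]⟩

theorem sum_label_add (s : LockState H) (j : J) :
    ∑ d, (if W.label (j + d) = s then 1 else 0) = W.fiberCard s := by
  rw [fiberCard, Finset.card_filter,
    ← Equiv.sum_comp (Equiv.addLeft j) fun d => if W.label d = s then 1 else 0]
  rfl

/-- Each block contributes a translate of the same fiber of `label`. Independence of `θ` is the
point: emission probabilities carry no information on the shifts. -/
theorem card_decode_eq (θ : I → J) (s : LockState H) :
    (Finset.univ.filter fun x => W.decode θ x = s).card = Fintype.card I * W.fiberCard s := by
  rw [Finset.card_filter, ← Equiv.sum_comp W.split.symm, Fintype.sum_prod_type]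
  simp only [decode, block, Equiv.apply_symm_apply]
  have : ∀ i, ∑ j, (if W.label (j + θ i) = s then 1 else 0) = W.fiberCard s := by
    intro i
    rw [fiberCard, Finset.card_filter,
      ← Equiv.sum_comp (Equiv.addRight (θ i)) fun d => if W.label d = s then 1 else 0]
    rfl
  simp [this]

/-- Membership in `E` ignores coordinate `i`, so given `E` the shift `θ i` is still uniform on `J`;
the proportion is written without division. -/
theorem card_filter_label {E : Finset (I → J)} {T : Finset I} (hE : Determined E T) {i : I}
    (hi : i ∉ T) (j : J) (s : LockState H) :
    (E.filter fun θ => W.label (j + θ i) = s).card * Fintype.card J = E.card * W.fiberCard s := by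
  classical
  have mem : ∀ θ d, Function.update θ i d ∈ E ↔ θ ∈ E := by
    intro θ d
    have : ∀ k ∈ T, Function.update θ i d k = θ k := by
      intro k hk
      rw [Function.update_of_ne]
      rintro rfl
      exact hi hk
    exact ⟨hE _ _ this, hE _ _ fun k hk => (this k hk).symm⟩
  have := sum_sum_update i fun θ : I → J =>
    (if θ ∈ E then 1 else 0) * (if W.label (j + θ i) = s then 1 else 0)
  simp only [mem, Function.update_self, ← Finset.mul_sum, W.sum_label_add] at this
  rw [← Finset.sum_mul] at this
  simp only [Finset.sum_boole, ite_mul, one_mul, zero_mul, smul_eq_mul,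
    Finset.sum_ite_mem, Finset.filter_mem_eq_inter, Finset.univ_inter, Nat.cast_id] at this
  rw [this, mul_comm]

/-- Distinct unrevealed blocks have independent uniform shifts, so the chances of the prescribed
labels multiply. -/
theorem card_filter_match {E : Finset (I → J)} {T : Finset I} (hE : Determined E T)
    {τ : Traj H X} (hT : ∀ h, W.block (τ h).2.1 ∉ T)
    (hτ : Function.Injective fun h => W.block (τ h).2.1) :
    (E.filter (W.Match τ)).card * Fintype.card J ^ H = E.card * ∏ h, W.fiberCard (τ h).1 := by
  classical
  -- The steps are imposed one at a time; determinedness is carried along so that the block of the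
  -- next step is still unrevealed.
  have key : ∀ R : Finset (Fin H),
      Determined (E.filter fun θ => ∀ h ∈ R, W.decode θ (τ h).2.1 = (τ h).1)
        (T ∪ R.image fun h => W.block (τ h).2.1) ∧
      (E.filter fun θ => ∀ h ∈ R, W.decode θ (τ h).2.1 = (τ h).1).card * Fintype.card J ^ R.card =
        E.card * ∏ h ∈ R, W.fiberCard (τ h).1 := by
    intro R
    induction R using Finset.induction_on with
    | empty => simpa using hE
    | insert g R hg ih =>
      constructor
      · intro θ θ' hθ h
        rw [Finset.mem_filter] at h ⊢
        refine ⟨hE θ θ' (fun i hi => hθ i (Finset.mem_union_left _ hi)) h.1, fun g hg => ?_⟩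
        rw [← h.2 g hg, decode, decode, hθ (W.block (τ g).2.1)
          (Finset.mem_union_right _ (Finset.mem_image_of_mem _ hg))]
      · have split : (E.filter fun θ => ∀ h ∈ insert g R, W.decode θ (τ h).2.1 = (τ h).1) =
            (E.filter fun θ => ∀ h ∈ R, W.decode θ (τ h).2.1 = (τ h).1).filter
              fun θ => W.label ((W.split (τ g).2.1).2 + θ (W.block (τ g).2.1)) = (τ g).1 := by
          rw [Finset.filter_filter]
          refine Finset.filter_congr fun θ _ => ?_
          rw [Finset.forall_mem_insert, and_comm]
          rfl
        have fresh : W.block (τ g).2.1 ∉ T ∪ R.image fun h => W.block (τ h).2.1 := by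
          rw [Finset.mem_union, not_or]
          refine ⟨hT g, fun h => ?_⟩
          obtain ⟨h, hh, heq⟩ := Finset.mem_image.1 h
          exact hg (hτ heq ▸ hh)
        rw [split, Finset.card_insert_of_notMem hg, Finset.prod_insert hg, pow_succ', ← mul_assoc,
          W.card_filter_label ih.1 fresh, mul_right_comm, ih.2]
        ring
  have := (key Finset.univ).2
  simp only [Finset.mem_univ, true_imp_iff, Finset.card_univ, Fintype.card_fin] at this
  exact this

variable [Nonempty I]

/-- The lock with decoding function `W.decode θ`. -/
def mdp (θ : I → J) : BlockMDP H (LockState H) X (Fin 2) :=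
  lockMDP H W.H_pos (W.decode θ) (W.decode_surj θ)

/-- The law of the latent states of a lock when the actions `a` are played. -/
def latent (a : Fin H → Fin 2) : PMF (Fin H → LockState H) := (W.mdp 0).latentLaw a

theorem latentLaw_mdp (θ : I → J) (a : Fin H → Fin 2) :
    (W.mdp θ).latentLaw a = W.latent a := by
  rw [latent, BlockMDP.latentLaw, BlockMDP.latentLaw,
    BlockMDP.latentStep_congr (M := W.mdp θ) (M' := W.mdp 0) rfl rfl]

/-- The probability of `τ` in a lock whose decoding function is consistent with `τ`. -/
def weight (π : Policy H X (Fin 2)) (τ : Traj H X) : ℝ≥0∞ :=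
  W.latent (fun h => (τ h).2.2.1) (fun h => (τ h).1) *
    ((∏ h, ((Fintype.card I * W.fiberCard (τ h).1 : ℕ) : ℝ≥0∞)⁻¹) *
    (actionLaw π (fun h => (τ h).2.1) (fun h => (τ h).2.2.2) (fun h => (τ h).2.2.1) *
      ∏ h, coin (lockReward H (τ h).1) (τ h).2.2.2))

/-- Given consistency every factor is free of `θ`: this likelihood is constant on consistent shifts,
so the posterior is uniform on them. -/
theorem trajLaw_mdp (θ : I → J) (π : Policy H X (Fin 2)) (τ : Traj H X) :
    (W.mdp θ).trajLaw π τ = if W.Match τ θ then W.weight π τ else 0 := by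
  have emit : ∀ s h x, (W.mdp θ).emit h s x =
      if W.decode θ x = s then ((Fintype.card I * W.fiberCard s : ℕ) : ℝ≥0∞)⁻¹ else 0 := by
    intro s h x
    rw [← W.card_decode_eq θ]
    simp [mdp, lockMDP, PMF.uniformOfFinset_apply]
  rw [BlockMDP.trajLaw_apply, latentLaw_mdp]
  simp only [emit]
  split_ifs with h
  · rw [Finset.prod_congr rfl fun g _ => if_pos (h g)]
    rfl
  · rw [Match, not_forall] at h
    obtain ⟨g, hg⟩ := h
    rw [Finset.prod_eq_zero (Finset.mem_univ g) (if_neg hg), zero_mul, mul_zero]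

theorem sum_trajLaw_mdp (E : Finset (I → J)) (π : Policy H X (Fin 2)) (τ : Traj H X) :
    ∑ θ ∈ E, (W.mdp θ).trajLaw π τ = (E.filter (W.Match τ)).card * W.weight π τ := by
  simp only [trajLaw_mdp]
  rw [← Finset.sum_filter, Finset.sum_const, nsmul_eq_mul]

/-! ### The ideal trajectory law -/

/-- The law of a trajectory with independent uniform emissions and zero rewards. -/
def ideal [Nonempty X] (π : Policy H X (Fin 2)) : PMF (Traj H X) :=
  (PMF.uniformOfFintype (Fin H → X)).bind fun x =>
    ((actionLaw π x fun _ => false).bind fun a => (W.latent a).map (Prod.mk a)).map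
      fun u h => (u.2 h, x h, u.1 h, false)

theorem ideal_apply [Nonempty X] (π : Policy H X (Fin 2)) {τ : Traj H X}
    (hτ : ∀ h, (τ h).2.2.2 = false) :
    W.ideal π τ = ((Fintype.card X : ℝ≥0∞) ^ H)⁻¹ *
      (actionLaw π (fun h => (τ h).2.1) (fun h => (τ h).2.2.2) (fun h => (τ h).2.2.1) *
        W.latent (fun h => (τ h).2.2.1) (fun h => (τ h).1)) := by
  have hr : (fun h => (τ h).2.2.2) = fun _ => false := funext hτ
  have inj : Function.Injective2 fun (x : Fin H → X)
      (u : (Fin H → Fin 2) × (Fin H → LockState H)) h => ((u.2 h, x h, u.1 h, false) :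
        Step (LockState H) X (Fin 2)) := by
    intro x x' u u' h
    simp only [funext_iff, Prod.mk.injEq] at h
    exact ⟨funext fun i => (h i).2.1, Prod.ext (funext fun i => (h i).2.2.1) (funext fun i => (h i).1)⟩
  have inj' : Function.Injective2 (Prod.mk : (Fin H → Fin 2) → (Fin H → LockState H) → _) :=
    fun _ _ _ _ h => Prod.mk.inj h
  have eq : τ = fun h => ((τ h).1, (τ h).2.1, (τ h).2.2.1, false) := by
    funext h
    rw [← hτ h]
  have := bind_map_apply_of_injective2 (PMF.uniformOfFintype (Fin H → X))
    (fun x => (actionLaw π x fun _ => false).bind fun a => (W.latent a).map (Prod.mk a)) inj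
    (fun h => (τ h).2.1) (fun h => (τ h).2.2.1, fun h => (τ h).1)
  rw [bind_map_apply_of_injective2 _ _ inj'] at this
  rw [hr, ideal]
  conv_lhs => rw [eq]
  refine this.trans ?_
  simp

/-- The trajectory `τ` has zero rewards, and its emissions are in distinct blocks outside `T`. -/
structure IsGood (T : Finset I) (τ : Traj H X) : Prop where
  obs_reward : ∀ h, (τ h).2.2.2 = false
  reward : ∀ h, lockReward H (τ h).1 = 0
  fresh : ∀ h, W.block (τ h).2.1 ∉ T
  inj : Function.Injective fun h => W.block (τ h).2.1

/-- A state with fiber `f` is matched with chance `f / |J|` and emits a given matching `x` with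
chance `1 / (|I| f)`. The `f` cancels, leaving the uniform chance `1 / |X|` at each step. -/
theorem sum_trajLaw_mdp_of_isGood [Nonempty X] {E : Finset (I → J)} {T : Finset I}
    (hE : Determined E T) (π : Policy H X (Fin 2)) {τ : Traj H X} (hτ : W.IsGood T τ) :
    ∑ θ ∈ E, (W.mdp θ).trajLaw π τ = E.card * W.ideal π τ := by
  have coins : ∏ h, coin (lockReward H (τ h).1) (τ h).2.2.2 = 1 := by
    refine Finset.prod_eq_one fun h _ => ?_
    rw [hτ.reward, hτ.obs_reward]
    simp [coin]
  have hJ : (Fintype.card J : ℝ≥0∞) ≠ 0 := by simp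
  have hJ' : (Fintype.card J : ℝ≥0∞) ^ H ≠ 0 := pow_ne_zero _ hJ
  have hf : ∀ h, (W.fiberCard (τ h).1 : ℝ≥0∞) ≠ 0 := fun h => by
    simpa using (W.fiberCard_pos (τ h).1).ne'
  have hP : (∏ h, (W.fiberCard (τ h).1 : ℝ≥0∞)) ≠ 0 := Finset.prod_ne_zero_iff.2 fun h _ => hf h
  have hP' : (∏ h, (W.fiberCard (τ h).1 : ℝ≥0∞)) ≠ ⊤ :=
    ENNReal.prod_ne_top fun h _ => ENNReal.natCast_ne_top _
  have count : ((E.filter (W.Match τ)).card : ℝ≥0∞) *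
      ∏ h, ((Fintype.card I * W.fiberCard (τ h).1 : ℕ) : ℝ≥0∞)⁻¹ =
      E.card * ((Fintype.card X : ℝ≥0∞) ^ H)⁻¹ := by
    have := congrArg (Nat.cast : ℕ → ℝ≥0∞) (W.card_filter_match hE hτ.fresh hτ.inj)
    push_cast at this
    have e1 : ∏ h, ((Fintype.card I * W.fiberCard (τ h).1 : ℕ) : ℝ≥0∞)⁻¹ =
        ((Fintype.card I : ℝ≥0∞) ^ H)⁻¹ * (∏ h, (W.fiberCard (τ h).1 : ℝ≥0∞))⁻¹ := by
      rw [← ENNReal.mul_inv (Or.inr hP') (Or.inr hP),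
        ← ENNReal.prod_inv_distrib (f := fun h =>
          ((Fintype.card I * W.fiberCard (τ h).1 : ℕ) : ℝ≥0∞)) fun i _ j _ _ =>
            Or.inr (ENNReal.natCast_ne_top _)]
      push_cast
      rw [Finset.prod_mul_distrib]
      simp
    rw [e1, W.card_emission]
    push_cast
    rw [mul_pow, ENNReal.mul_inv (Or.inr (by simp)) (Or.inr hJ'), mul_left_comm,
      mul_left_comm (E.card : ℝ≥0∞)]
    congr 1
    rw [← div_eq_mul_inv, ← div_eq_mul_inv, ENNReal.div_eq_div_iff hJ' (by simp) hP hP',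
      mul_comm, this, mul_comm]
  rw [sum_trajLaw_mdp, W.ideal_apply π hτ.obs_reward, weight, coins, mul_one, ← mul_assoc,
    mul_right_comm, ← mul_assoc, count]
  ring

end Scrambler

theorem expect_nonneg {α : Type} [Fintype α] (p : PMF α) {f : α → ℝ} (h : ∀ a, 0 ≤ f a) :
    0 ≤ expect p f :=
  Finset.sum_nonneg fun a _ => mul_nonneg ENNReal.toReal_nonneg (h a)

theorem expect_uniform {α : Type} [Fintype α] [Nonempty α] (f : α → ℝ) :
    expect (PMF.uniformOfFintype α) f = (∑ a, f a) / Fintype.card α := by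
  simp [expect, Finset.mul_sum, div_eq_inv_mul]

/-! ### Two measures of equal mass that agree on a set. -/

section compare

variable {α : Type} [Fintype α] {a b : α → ℝ} {G : α → Prop} [DecidablePred G]

theorem sum_not_eq_of_agree (hab : ∑ t, a t = ∑ t, b t) (hG : ∀ t, G t → a t = b t) :
    ∑ t, a t * (if G t then 0 else 1) = ∑ t, b t * (if G t then 0 else 1) := by
  have : ∀ c : α → ℝ, ∑ t, c t * (if G t then 0 else 1) =
      ∑ t, c t - ∑ t, if G t then c t else 0 := by
    intro c
    rw [← Finset.sum_sub_distrib]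
    refine Finset.sum_congr rfl fun t _ => ?_
    split_ifs <;> simp
  rw [this, this, hab]
  congr 1
  refine Finset.sum_congr rfl fun t _ => ?_
  split_ifs with h
  · exact hG t h
  · rfl

/-- The masses off `G` also coincide, and the difference of the two integrals lives there; hence the
factor 2. -/
theorem abs_sum_sub_le_of_agree (ha : ∀ t, 0 ≤ a t) (hb : ∀ t, 0 ≤ b t)
    (hab : ∑ t, a t = ∑ t, b t) (hG : ∀ t, G t → a t = b t) {f : α → ℝ} (hf : ∀ t, |f t| ≤ 1) :
    |∑ t, a t * f t - ∑ t, b t * f t| ≤ 2 * ∑ t, b t * (if G t then 0 else 1) := by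
  rw [← Finset.sum_sub_distrib, two_mul]
  nth_rewrite 1 [← sum_not_eq_of_agree hab hG]
  rw [← Finset.sum_add_distrib]
  refine (Finset.abs_sum_le_sum_abs _ _).trans (Finset.sum_le_sum fun t _ => ?_)
  split_ifs with h
  · simp [hG t h]
  · rw [← sub_mul, abs_mul, mul_one, mul_one]
    refine (mul_le_of_le_one_right (abs_nonneg _) (hf t)).trans ?_
    rw [abs_le]
    constructor <;> linarith [ha t, hb t]

end compare

namespace Scrambler

variable {H : ℕ} {X I J : Type} [Fintype X] [Fintype I] [DecidableEq I] [Fintype J] [AddGroup J]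
  (W : Scrambler H X I J) [Nonempty I]

/-- The law of the latent state of step `h` under any fixed action sequence. -/
def layer (h : Fin H) : PMF (LockState H) := (W.latent 0).map fun s => s h

theorem isLayerLaw_layer (h : Fin H) : IsLayerLaw h (W.layer h) :=
  isLayerLaw_latentLaw W.H_pos _ (W.decode_surj 0) 0 h

theorem latent_map (a : Fin H → Fin 2) (h : Fin H) :
    ((W.latent a).map fun s => s h) = W.layer h :=
  (isLayerLaw_latentLaw W.H_pos _ (W.decode_surj 0) a h).eq (W.isLayerLaw_layer h)

theorem expect_latent (a : Fin H → Fin 2) (h : Fin H) (f : LockState H → ℝ) :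
    expect (W.latent a) (fun s => f (s h)) = expect (W.layer h) f := by
  rw [← W.latent_map a h, expect_map]

/-- Only the two live states of the last layer pay, and each has mass `2 ^ (-H)`. -/
theorem expect_layer_reward (h : Fin H) :
    expect (W.layer h) (fun s => if lockReward H s = 0 then 0 else 1) ≤
      if (h : ℕ) + 1 = H then 2 * (1 / 2) ^ H else 0 := by
  have hl := W.isLayerLaw_layer h
  split_ifs with hh
  · have le : expect (W.layer h) (fun s => if lockReward H s = 0 then 0 else 1) ≤
        expect (W.layer h) fun s => (if s = some (h, (0 : Fin 2).castSucc) then 1 else 0) +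
          if s = some (h, (1 : Fin 2).castSucc) then 1 else 0 := by
      refine expect_mono _ fun s hs => ?_
      obtain ⟨b, rfl⟩ := hl.2 s hs
      fin_cases b
      · simp only [Fin.castSucc_zero, Fin.zero_eta, if_true]
        split_ifs <;> norm_num
      · simp only [Fin.castSucc_one, Fin.mk_one, if_true]
        split_ifs <;> norm_num
      · simp [lockReward]
    refine le.trans ?_
    rw [expect_add, expect_ite_eq, expect_ite_eq, hl.1, hl.1, hh]
    simp [two_mul]
  · refine (expect_congr _ (g := fun _ => 0) fun s hs => ?_).le.trans (expect_const _ _).le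
    obtain ⟨b, rfl⟩ := hl.2 s hs
    rw [if_pos]
    simp [lockReward, hh]

theorem expect_latent_reward (a : Fin H → Fin 2) :
    expect (W.latent a) (fun s => ∑ h, if lockReward H (s h) = 0 then 0 else 1) ≤
      2 * (1 / 2) ^ H := by
  rw [expect_finset_sum]
  simp only [W.expect_latent a _ fun s => if lockReward H s = 0 then 0 else 1]
  refine (Finset.sum_le_sum fun h _ => W.expect_layer_reward h).trans ?_
  rw [Finset.sum_eq_single ⟨H - 1, Nat.sub_lt W.H_pos one_pos⟩]
  · split_ifs
    · exact le_rfl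
    · positivity
  · intro h _ hne
    rw [if_neg]
    intro hh
    exact hne (Fin.ext (by simp only; omega))
  · simp

/-- Resampling emission `h` alone suffices. The normalization by `|J|` fits events about blocks, as
a block holds `|J|` of the `|I| |J|` emissions. -/
theorem expect_uniform_update_le {H : ℕ} {X I J : Type} [Fintype X] [Fintype I] [Fintype J]
    [Nonempty I] [Nonempty X] [Nonempty J] (W : Scrambler H X I J) (h : Fin H) {F : (Fin H → X) → ℝ} {c : ℝ}
    (hF : ∀ x, ∑ d, F (Function.update x h d) ≤ c * Fintype.card J) :
    expect (PMF.uniformOfFintype (Fin H → X)) F ≤ c / Fintype.card I := by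
  have hX : (0 : ℝ) < Fintype.card X := by exact_mod_cast Fintype.card_pos
  have hI : (0 : ℝ) < Fintype.card I := by exact_mod_cast Fintype.card_pos
  have hc : (Fintype.card X : ℝ) = Fintype.card I * Fintype.card J := by
    exact_mod_cast W.card_emission
  have key := (sum_sum_update h F).symm.trans_le (Finset.sum_le_sum fun x _ => hF x)
  rw [Finset.sum_const, nsmul_eq_mul, nsmul_eq_mul, Finset.card_univ] at key
  have hJ : (0 : ℝ) < Fintype.card J := by exact_mod_cast Fintype.card_pos
  have hN : (0 : ℝ) < Fintype.card (Fin H → X) := by exact_mod_cast Fintype.card_pos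
  rw [expect_uniform, div_le_div_iff₀ hN hI]
  rw [hc] at key
  refine le_of_mul_le_mul_right ?_ hJ
  linarith

theorem sum_block_eq (i : I) : ∑ d, (if W.block d = i then 1 else 0 : ℝ) = Fintype.card J := by
  rw [← Equiv.sum_comp W.split.symm, Fintype.sum_prod_type]
  simp [block]

theorem expect_block_mem [Nonempty X] (T : Finset I) (h : Fin H) :
    expect (PMF.uniformOfFintype (Fin H → X)) (fun x => if W.block (x h) ∈ T then 1 else 0) ≤
      T.card / Fintype.card I := by
  refine W.expect_uniform_update_le h fun x => le_of_eq ?_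
  simp only [Function.update_self]
  calc ∑ d, (if W.block d ∈ T then 1 else 0 : ℝ)
      = ∑ d, ∑ i ∈ T, if W.block d = i then 1 else 0 := by simp
    _ = T.card * Fintype.card J := by
        rw [Finset.sum_comm]
        simp only [W.sum_block_eq]
        simp

theorem expect_block_eq [Nonempty X] {g h : Fin H} (hgh : g ≠ h) :
    expect (PMF.uniformOfFintype (Fin H → X))
      (fun x => if W.block (x h) = W.block (x g) then 1 else 0) ≤ 1 / Fintype.card I := by
  refine W.expect_uniform_update_le h fun x => le_of_eq ?_
  simp only [Function.update_self, Function.update_of_ne hgh, W.sum_block_eq, one_mul]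

/-- A bound for the probability under the ideal law that a trajectory is not good. -/
def defect (H N K : ℕ) : ℝ := 2 * (1 / 2) ^ H + (H * K + H ^ 2) / N

open Classical in
-- Union bound over the ways to fail: a rewarding state, an emission in a revealed block, or two
-- emissions in one block.
theorem expect_ideal_not_isGood_le [Nonempty X] (T : Finset I) (π : Policy H X (Fin 2)) :
    expect (W.ideal π) (fun τ => if W.IsGood T τ then 0 else 1) ≤
      defect H (Fintype.card I) T.card := by
  simp only [ideal, expect_bind, expect_map]
  have inner : ∀ x : Fin H → X,
      (expect (actionLaw π x fun _ => false) fun a => expect (W.latent a) fun s =>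
        if W.IsGood T fun h => (s h, x h, a h, false) then (0 : ℝ) else 1) ≤
      2 * (1 / 2) ^ H + (∑ h, (if W.block (x h) ∈ T then 1 else 0) +
        ∑ h, ∑ g, if g ≠ h then (if W.block (x h) = W.block (x g) then 1 else 0) else 0) := by
    intro x
    refine (expect_mono _ fun a _ => ?_).trans (expect_const _ _).le
    have : ∀ s : Fin H → LockState H,
        (if W.IsGood T fun h => (s h, x h, a h, false) then (0 : ℝ) else 1) ≤
        (∑ h, if lockReward H (s h) = 0 then 0 else 1) +
        (∑ h, (if W.block (x h) ∈ T then 1 else 0) +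
        ∑ h, ∑ g, if g ≠ h then (if W.block (x h) = W.block (x g) then 1 else 0) else 0) := by
      intro s
      have n1 : ∀ h : Fin H, (0 : ℝ) ≤ if lockReward H (s h) = 0 then 0 else 1 := by
        intro h; split_ifs <;> norm_num
      have n2 : ∀ h : Fin H, (0 : ℝ) ≤ if W.block (x h) ∈ T then 1 else 0 := by
        intro h; split_ifs <;> norm_num
      have n3 : ∀ h g : Fin H, (0 : ℝ) ≤ if g ≠ h then
          (if W.block (x h) = W.block (x g) then 1 else 0) else 0 := by
        intro h g; split_ifs <;> norm_num
      have s1 := Finset.sum_nonneg fun h (_ : h ∈ Finset.univ) => n1 h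
      have s2 := Finset.sum_nonneg fun h (_ : h ∈ Finset.univ) => n2 h
      have s3 := Finset.sum_nonneg fun h (_ : h ∈ Finset.univ) =>
        Finset.sum_nonneg fun g (_ : g ∈ Finset.univ) => n3 h g
      split_ifs with hg
      · positivity
      · by_cases h1 : ∀ h, lockReward H (s h) = 0
        · by_cases h2 : ∀ h, W.block (x h) ∉ T
          · have h3 : ¬ Function.Injective fun h => W.block (x h) :=
              fun h3 => hg ⟨fun _ => rfl, h1, h2, h3⟩
            simp only [Function.Injective, not_forall] at h3
            obtain ⟨g, h, heq, hne⟩ := h3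
            have e1 := Finset.single_le_sum (fun g _ => n3 h g) (Finset.mem_univ g)
            have e2 := Finset.single_le_sum (fun h (_ : h ∈ Finset.univ) =>
              Finset.sum_nonneg fun g (_ : g ∈ Finset.univ) => n3 h g) (Finset.mem_univ h)
            rw [if_pos hne, if_pos heq.symm] at e1
            linarith
          · push Not at h2
            obtain ⟨h, hh⟩ := h2
            have := Finset.single_le_sum (fun h _ => n2 h) (Finset.mem_univ h)
            rw [if_pos hh] at this
            linarith
        · push Not at h1
          obtain ⟨h, hh⟩ := h1
          have := Finset.single_le_sum (fun h _ => n1 h) (Finset.mem_univ h)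
          rw [if_neg hh] at this
          linarith
    refine (expect_mono _ fun s _ => this s).trans ?_
    rw [expect_add, expect_const]
    exact add_le_add_left (W.expect_latent_reward a) _
  refine (expect_mono _ fun x _ => inner x).trans ?_
  rw [expect_add, expect_const, expect_add, expect_finset_sum, expect_finset_sum, defect]
  refine add_le_add_right ?_ _
  rw [add_div]
  refine add_le_add ?_ ?_
  · refine (Finset.sum_le_sum fun h _ => W.expect_block_mem T h).trans ?_
    simp [mul_div_assoc]
  · have : ∀ h g : Fin H, (expect (PMF.uniformOfFintype (Fin H → X)) fun x => if g ≠ h then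
        (if W.block (x h) = W.block (x g) then 1 else 0) else 0) ≤ 1 / Fintype.card I := by
      intro h g
      by_cases hgh : g ≠ h
      · simp only [if_pos hgh]
        exact W.expect_block_eq hgh
      · simp only [if_neg hgh, expect_const]
        positivity
    simp only [expect_finset_sum]
    refine (Finset.sum_le_sum fun h _ => Finset.sum_le_sum fun g _ => this h g).trans ?_
    simp only [Finset.sum_const, Finset.card_univ, Fintype.card_fin, nsmul_eq_mul]
    exact le_of_eq (by ring)

theorem defect_nonneg (H N K : ℕ) : 0 ≤ defect H N K := by
  unfold defect
  positivity

theorem defect_mono {H N K K' : ℕ} (h : K ≤ K') : defect H N K ≤ defect H N K' := by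
  unfold defect
  gcongr

/-! ### Comparison with the ideal law -/

theorem sum_expect_eq (E : Finset (I → J)) (π : Policy H X (Fin 2)) (f : Traj H X → ℝ) :
    ∑ θ ∈ E, expect ((W.mdp θ).trajLaw π) f =
      ∑ τ, (∑ θ ∈ E, (W.mdp θ).trajLaw π τ).toReal * f τ := by
  simp only [expect]
  rw [Finset.sum_comm]
  refine Finset.sum_congr rfl fun τ _ => ?_
  rw [← Finset.sum_mul, ENNReal.toReal_sum fun θ _ => PMF.apply_ne_top _ _]

theorem sum_toReal_sum (E : Finset (I → J)) (π : Policy H X (Fin 2)) :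
    ∑ τ, (∑ θ ∈ E, (W.mdp θ).trajLaw π τ).toReal = E.card := by
  have := W.sum_expect_eq E π fun _ => 1
  simp only [mul_one, expect_const] at this
  rw [← this]
  simp

variable [Nonempty X] {E : Finset (I → J)} {T : Finset I}

open Classical in
theorem abs_sum_expect_sub_le (hE : Determined E T) (π : Policy H X (Fin 2)) {f : Traj H X → ℝ} (hf : ∀ τ, |f τ| ≤ 1) :
    |∑ θ ∈ E, expect ((W.mdp θ).trajLaw π) f - E.card * expect (W.ideal π) f| ≤
      2 * defect H (Fintype.card I) T.card * E.card := by
  have := abs_sum_sub_le_of_agree (a := fun τ => (∑ θ ∈ E, (W.mdp θ).trajLaw π τ).toReal)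
    (b := fun τ => (E.card * W.ideal π τ).toReal) (G := W.IsGood T)
    (fun _ => ENNReal.toReal_nonneg) (fun _ => ENNReal.toReal_nonneg)
    (by rw [W.sum_toReal_sum]; simp [← Finset.mul_sum, sum_toReal])
    (fun τ hτ => by rw [W.sum_trajLaw_mdp_of_isGood hE π hτ]) hf
  rw [← W.sum_expect_eq] at this
  simp only [ENNReal.toReal_mul, ENNReal.toReal_natCast, mul_assoc, ← Finset.mul_sum] at this
  refine this.trans ?_
  rw [mul_assoc, mul_comm (defect _ _ _)]
  have := W.expect_ideal_not_isGood_le T π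
  rw [expect] at this
  gcongr

open Classical in
-- This one-sided version has no factor 2, since only the mass off the good set, which is the same
-- under both laws, can contribute.
theorem sum_expect_le (hE : Determined E T) (π : Policy H X (Fin 2)) {f : Traj H X → ℝ} {C : ℝ} (hC : 0 ≤ C)
    (hf : ∀ τ, f τ ≤ C) (h0 : ∀ τ, W.IsGood T τ → f τ ≤ 0) :
    ∑ θ ∈ E, expect ((W.mdp θ).trajLaw π) f ≤
      C * defect H (Fintype.card I) T.card * E.card := by
  have := sum_not_eq_of_agree (a := fun τ => (∑ θ ∈ E, (W.mdp θ).trajLaw π τ).toReal)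
    (b := fun τ => (E.card * W.ideal π τ).toReal) (G := W.IsGood T)
    (by rw [W.sum_toReal_sum]; simp [← Finset.mul_sum, sum_toReal])
    (fun τ hτ => by rw [W.sum_trajLaw_mdp_of_isGood hE π hτ])
  calc ∑ θ ∈ E, expect ((W.mdp θ).trajLaw π) f
      ≤ ∑ θ ∈ E, expect ((W.mdp θ).trajLaw π) (fun τ => (if W.IsGood T τ then 0 else 1) * C) := by
        refine Finset.sum_le_sum fun θ _ => expect_mono _ fun τ _ => ?_
        split_ifs with h
        · simpa using h0 τ h
        · simpa using hf τ
    _ = C * (E.card * expect (W.ideal π) fun τ => if W.IsGood T τ then 0 else 1) := by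
        simp only [expect_mul_const]
        rw [← Finset.sum_mul, W.sum_expect_eq, this, mul_comm]
        simp only [ENNReal.toReal_mul, ENNReal.toReal_natCast, mul_assoc, ← Finset.mul_sum]
        rfl
    _ ≤ C * (E.card * defect H (Fintype.card I) T.card) := by
        have := W.expect_ideal_not_isGood_le T π
        gcongr
    _ = _ := by ring

end Scrambler

theorem toOuterMeasure_le_one {α : Type} (p : PMF α) (s : Set α) : p.toOuterMeasure s ≤ 1 :=
  (p.toOuterMeasure.mono (Set.subset_univ s)).trans_eq
    ((p.toOuterMeasure_apply_eq_one_iff _).2 (Set.subset_univ _))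

/-- The law `p` of the next move is common to all `θ`, since the algorithm sees only the exchanges;
so the move can be fixed first. -/
theorem sum_toOuterMeasure_bind_le {ι α : Type} {β : Type*} (E : Finset ι) (p : PMF β)
    (q : ι → β → PMF α) (s : ι → Set α) {B : ℝ≥0∞}
    (h : ∀ m, ∑ θ ∈ E, (q θ m).toOuterMeasure (s θ) ≤ B) :
    ∑ θ ∈ E, (p.bind (q θ)).toOuterMeasure (s θ) ≤ B := by
  simp only [PMF.toOuterMeasure_bind_apply]
  rw [← Summable.tsum_finsetSum fun _ _ => ENNReal.summable]
  calc ∑' m, ∑ θ ∈ E, p m * (q θ m).toOuterMeasure (s θ)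
      ≤ ∑' m, p m * B := by
        refine ENNReal.tsum_le_tsum fun m => ?_
        rw [← Finset.mul_sum]
        gcongr
        exact h m
    _ = B := by rw [ENNReal.tsum_mul_right, p.tsum_coe, one_mul]

namespace Scrambler

variable {H : ℕ} {X I J : Type} [Fintype X] [Fintype I] [DecidableEq I] [Fintype J] [AddGroup J]
  (W : Scrambler H X I J) [Nonempty I]

/-! ### Conditioning on a trajectory -/

/-- Bayes' rule: drawing `θ` and then `τ` amounts to drawing `τ` and then `θ` uniformly among the
consistent shifts. -/
theorem sum_sum_trajLaw_mul (E : Finset (I → J)) (π : Policy H X (Fin 2))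
    (F : (I → J) → Traj H X → ℝ≥0∞) :
    ∑ θ ∈ E, ∑ τ, (W.mdp θ).trajLaw π τ * F θ τ =
      ∑ τ, W.weight π τ * ∑ θ ∈ E.filter (W.Match τ), F θ τ := by
  rw [Finset.sum_comm]
  refine Finset.sum_congr rfl fun τ _ => ?_
  simp only [trajLaw_mdp, ite_mul, zero_mul, Finset.sum_filter, Finset.mul_sum, mul_ite, mul_zero]

theorem sum_weight_mul_card (E : Finset (I → J)) (π : Policy H X (Fin 2)) :
    ∑ τ, W.weight π τ * (E.filter (W.Match τ)).card = E.card := by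
  have := W.sum_sum_trajLaw_mul E π fun _ _ => 1
  simp only [mul_one, Finset.sum_const, nsmul_eq_mul] at this
  have one : ∀ θ, ∑ τ, (W.mdp θ).trajLaw π τ = 1 := fun θ =>
    (tsum_fintype _).symm.trans (PMF.tsum_coe _)
  rw [← this, Finset.sum_congr rfl fun θ _ => one θ]
  simp

theorem sum_sum_trajLaw_mul_le {E : Finset (I → J)} (π : Policy H X (Fin 2))
    {F : (I → J) → Traj H X → ℝ≥0∞} {B : ℝ≥0∞}
    (h : ∀ τ, ∑ θ ∈ E.filter (W.Match τ), F θ τ ≤ B * (E.filter (W.Match τ)).card) :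
    ∑ θ ∈ E, ∑ τ, (W.mdp θ).trajLaw π τ * F θ τ ≤ B * E.card := by
  rw [sum_sum_trajLaw_mul]
  calc ∑ τ, W.weight π τ * ∑ θ ∈ E.filter (W.Match τ), F θ τ
      ≤ ∑ τ, W.weight π τ * (B * (E.filter (W.Match τ)).card) := by
        gcongr with τ
        exact h τ
    _ = B * E.card := by
        rw [← W.sum_weight_mul_card E π, Finset.mul_sum]
        exact Finset.sum_congr rfl fun τ _ => mul_left_comm _ _ _

theorem toReal_trajLaw_mdp (θ : I → J) (π : Policy H X (Fin 2)) (τ : Traj H X) :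
    ((W.mdp θ).trajLaw π τ).toReal = if W.Match τ θ then (W.weight π τ).toReal else 0 := by
  rw [trajLaw_mdp]
  split_ifs <;> rfl

theorem sum_expect_eq_sum_match (E : Finset (I → J)) (π : Policy H X (Fin 2))
    (F : (I → J) → Traj H X → ℝ) :
    ∑ θ ∈ E, expect ((W.mdp θ).trajLaw π) (F θ) =
      ∑ τ, (W.weight π τ).toReal * ∑ θ ∈ E.filter (W.Match τ), F θ τ := by
  simp only [expect]
  rw [Finset.sum_comm]
  refine Finset.sum_congr rfl fun τ _ => ?_
  simp only [toReal_trajLaw_mdp, ite_mul, zero_mul, Finset.sum_filter, Finset.mul_sum, mul_ite,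
    mul_zero]

theorem sum_expect_le_of_match {E : Finset (I → J)} (π : Policy H X (Fin 2))
    {F : (I → J) → Traj H X → ℝ} {B : ℝ}
    (h : ∀ τ, ∑ θ ∈ E.filter (W.Match τ), F θ τ ≤ B * (E.filter (W.Match τ)).card) :
    ∑ θ ∈ E, expect ((W.mdp θ).trajLaw π) (F θ) ≤ B * E.card := by
  have one := W.sum_expect_eq_sum_match E π fun _ _ => 1
  simp only [expect_const, Finset.sum_const, nsmul_eq_mul, mul_one] at one
  rw [sum_expect_eq_sum_match, one, Finset.mul_sum]
  refine Finset.sum_le_sum fun τ _ => ?_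
  rw [mul_left_comm]
  exact mul_le_mul_of_nonneg_left (h τ) ENNReal.toReal_nonneg

theorem card_union_block_le (T : Finset I) (τ : Traj H X) :
    (T ∪ Finset.univ.image fun h => W.block (τ h).2.1).card ≤ T.card + H :=
  (Finset.card_union_le _ _).trans
    (Nat.add_le_add_left (Finset.card_image_le.trans_eq (Finset.card_fin H)) _)

/-! ### Runs of an oracle algorithm -/

open Classical in
-- The budget invariant is `T.card + k * H ≤ N`: each remaining call may reveal `H` more blocks. A
-- regression call reveals nothing unless the shift is bad for it, which costs `γ`; a final policy
-- succeeds on a fraction `β` at most.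
theorem sum_run_le (alg : OracleAlg H X (Fin 2)) (O : (I → J) → RegOracle H X (Fin 2))
    (c : Policy H X (Fin 2) → Label H X (Fin 2) → Fin H → Predictor X)
    (good : (I → J) → Policy H X (Fin 2) → Prop)
    (bad : (I → J) → Policy H X (Fin 2) → Label H X (Fin 2) → Fin H → Prop)
    (hO : ∀ θ t π L h, ¬ bad θ π L h → O θ t π L h = c π L h) {N : ℕ} {β γ : ℝ≥0∞}
    (hgood : ∀ E T, Determined E T → T.card ≤ N → ∀ π,
      ∑ θ ∈ E, (if good θ π then 1 else 0) ≤ β * E.card)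
    (hbad : ∀ E T, Determined E T → T.card ≤ N → ∀ π L h,
      ∑ θ ∈ E, (if bad θ π L h then 1 else 0) ≤ γ * E.card)
    (k : ℕ) (t : List (Exchange H X (Fin 2))) (E : Finset (I → J)) (T : Finset I)
    (hE : Determined E T) (hT : T.card + k * H ≤ N) :
    ∑ θ ∈ E, (run (W.mdp θ) (O θ) alg k t).toOuterMeasure {out | ∃ π, out = some π ∧ good θ π} ≤
      (β + k * γ) * E.card := by
  have output : ∀ (E : Finset (I → J)) (T : Finset I), Determined E T → T.card ≤ N → ∀ π,
      ∑ θ ∈ E, (PMF.pure (some π) : PMF (Option (Policy H X (Fin 2)))).toOuterMeasure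
        {out | ∃ π, out = some π ∧ good θ π} ≤ β * E.card := by
    intro E T hE hT π
    refine (Finset.sum_congr rfl fun θ _ => ?_).trans_le (hgood E T hE hT π)
    rw [PMF.toOuterMeasure_pure_apply]
    simp
  have none : ∀ (E : Finset (I → J)) (B : ℝ≥0∞),
      ∑ θ ∈ E, (PMF.pure none : PMF (Option (Policy H X (Fin 2)))).toOuterMeasure
        {out | ∃ π, out = some π ∧ good θ π} ≤ B := by
    intro E B
    simp [PMF.toOuterMeasure_pure_apply]
  induction k generalizing t E T with
  | zero =>
    simp only [run]
    refine sum_toOuterMeasure_bind_le E _ _ _ fun m => ?_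
    cases m with
    | output π => simpa using output E T hE (by omega) π
    | sample π => exact none E _
    | regress π L h => exact none E _
  | succ k ih =>
    simp only [run]
    have hk : T.card + H + k * H ≤ N := by
      rw [Nat.succ_mul] at hT
      omega
    refine sum_toOuterMeasure_bind_le E _ _ _ fun m => ?_
    cases m with
    | output π =>
      refine (output E T hE (by omega) π).trans ?_
      gcongr
      exact le_self_add
    | sample π =>
      dsimp only
      have : ∀ θ, (((W.mdp θ).obsLaw π).bind fun o =>
          run (W.mdp θ) (O θ) alg k (t ++ [.sample π o])).toOuterMeasure
            {out | ∃ π, out = some π ∧ good θ π} =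
          ∑ τ, (W.mdp θ).trajLaw π τ * (run (W.mdp θ) (O θ) alg k
            (t ++ [.sample π fun h => (τ h).2])).toOuterMeasure
              {out | ∃ π, out = some π ∧ good θ π} := by
        intro θ
        rw [BlockMDP.obsLaw, PMF.bind_map, PMF.toOuterMeasure_bind_apply, tsum_fintype]
        rfl
      simp only [this]
      -- The conditioning is on the whole trajectory with its latent states, which is more than the
      -- algorithm sees, so that `E` stays determined by a set of blocks.
      refine (W.sum_sum_trajLaw_mul_le π fun τ => ih _ _ _ (W.determined_filter_match hE τ)
        ((Nat.add_le_add_right (W.card_union_block_le T τ) _).trans hk)).trans ?_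
      gcongr
      exact Nat.le_succ k
    | regress π L h =>
      dsimp only
      have : ∀ θ, (run (W.mdp θ) (O θ) alg k
          (t ++ [.regress π L h (O θ t π L h)])).toOuterMeasure
            {out | ∃ π, out = some π ∧ good θ π} ≤
          (if bad θ π L h then 1 else 0) + (run (W.mdp θ) (O θ) alg k
            (t ++ [.regress π L h (c π L h)])).toOuterMeasure
              {out | ∃ π, out = some π ∧ good θ π} := by
        intro θ
        split_ifs with hb
        · exact (toOuterMeasure_le_one _ _).trans le_self_add
        · rw [hO θ t π L h hb, zero_add]
      refine (Finset.sum_le_sum fun θ _ => this θ).trans ?_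
      rw [Finset.sum_add_distrib]
      have hb := hbad E T hE (by omega) π L h
      have hr := ih (t ++ [.regress π L h (c π L h)]) E T hE (by omega)
      refine (add_le_add hb hr).trans (le_of_eq ?_)
      rw [← add_mul, Nat.cast_succ, add_mul (k : ℝ≥0∞), one_mul, add_left_comm, add_comm γ]

end Scrambler

/-! ### Predictors -/

theorem berLoss_eq (p v : ℝ) : berLoss p v = (v - p) ^ 2 + berLoss p p := by
  unfold berLoss
  ring

theorem Predictor.isAccurate_of_sq_le {S X : Type} [Fintype S] [Fintype X] {R : Predictor X}
    {D : S → PMF X} {β : PMF S} {f : S → ℝ} {ε : ℝ}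
    (h : (expect β fun s => expect (D s) fun x => (R.eval x - f s) ^ 2) ≤ ε) :
    R.IsAccurate D β f ε := by
  rw [Predictor.IsAccurate]
  simp only [fun s x => berLoss_eq (f s) (R.eval x), expect_add, expect_const]
  linarith

/-- The predictor which rounds `f` down to a multiple of `2 ^ (- b)`. -/
def Predictor.round {X : Type} (b : ℕ) (f : X → ℝ) : Predictor X where
  bits := b
  num x := ⟨min ⌊f x * 2 ^ b⌋₊ (2 ^ b), Nat.lt_succ_of_le (min_le_right _ _)⟩

theorem Predictor.abs_round_sub_le {X : Type} (b : ℕ) {f : X → ℝ} {x : X} (h0 : 0 ≤ f x)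
    (h1 : f x ≤ 1) : |(Predictor.round b f).eval x - f x| ≤ (1 / 2) ^ b := by
  have hb : (0 : ℝ) < 2 ^ b := by positivity
  have hm : min ⌊f x * 2 ^ b⌋₊ (2 ^ b) = ⌊f x * 2 ^ b⌋₊ := by
    refine min_eq_left (Nat.floor_le_of_le ?_)
    push_cast
    nlinarith
  have l1 := Nat.floor_le (mul_nonneg h0 hb.le)
  have l2 := Nat.lt_floor_add_one (f x * 2 ^ b)
  simp only [Predictor.round, Predictor.eval, hm]
  rw [div_sub' hb.ne', abs_div, abs_of_pos hb, one_div, inv_pow, div_eq_mul_inv]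
  refine mul_le_of_le_one_left (by positivity) ?_
  rw [abs_le]
  constructor <;> linarith

theorem Predictor.round_mem {X : Type} (b : ℕ) (f : X → ℝ) (x : X) :
    0 ≤ (Predictor.round b f).eval x ∧ (Predictor.round b f).eval x ≤ 1 := by
  simp only [Predictor.round, Predictor.eval]
  refine ⟨by positivity, div_le_one_of_le₀ ?_ (by positivity)⟩
  exact_mod_cast min_le_right _ _

namespace BlockMDP

variable {H : ℕ} {S X A : Type} [Fintype S] [DecidableEq S] [Fintype X] [Fintype A]

theorem labelMean_mem (M : BlockMDP H S X A) (π : Policy H X A) (L : Label H X A) (h : Fin H)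
    (s : S) : 0 ≤ M.labelMean π L h s ∧ M.labelMean π L h s ≤ 1 := by
  have hd : 0 ≤ expect (M.trajLaw π) fun τ => if M.decode (τ h).2.1 = s then 1 else 0 :=
    expect_nonneg _ fun τ => by split_ifs <;> norm_num
  refine ⟨div_nonneg (expect_nonneg _ fun τ => ?_) hd, div_le_one_of_le₀ (expect_mono _ fun τ _ => ?_) hd⟩
  · split_ifs
    · exact (L _).2.1
    · exact le_rfl
  · split_ifs
    · exact (L _).2.2
    · exact le_rfl

/-- Supplies the fallback answer for bad shifts: the true conditional mean, rounded to enough bits.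
-/
theorem exists_isAccurate (M : BlockMDP H S X A) {ε : ℝ} (hε : 0 < ε) (π : Policy H X A)
    (L : Label H X A) (h : Fin H) :
    ∃ R : Predictor X, R.IsAccurate (M.emit h) (M.visit π h) (M.labelMean π L h) ε := by
  obtain ⟨b, hb⟩ := exists_pow_lt_of_lt_one hε (by norm_num : (1 / 2 : ℝ) < 1)
  refine ⟨Predictor.round b fun x => M.labelMean π L h (M.decode x),
    Predictor.isAccurate_of_sq_le ?_⟩
  refine (expect_mono _ fun s _ => (expect_mono _ fun x hx => ?_).trans
    (expect_const _ ε).le).trans (expect_const _ ε).le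
  have hm := M.labelMean_mem π L h (M.decode x)
  have hr := Predictor.abs_round_sub_le b (f := fun x => M.labelMean π L h (M.decode x))
    hm.1 hm.2
  rw [M.decode_emit h s x hx] at hr
  rw [← sq_abs]
  have hp : ((1 / 2 : ℝ)) ^ b ≤ 1 := pow_le_one₀ (by norm_num) (by norm_num)
  nlinarith [abs_nonneg ((Predictor.round b fun x => M.labelMean π L h (M.decode x)).eval x -
    M.labelMean π L h s)]

/-- The expectation `E[(L - v) 1(s_h = s)]`. -/
def centered (M : BlockMDP H S X A) (π : Policy H X A) (L : Label H X A) (h : Fin H) (v : ℝ)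
    (s : S) : ℝ :=
  expect (M.trajLaw π) fun τ =>
    ((L fun g => (τ g).2 : unitInterval) - v) * if (τ h).1 = s then 1 else 0

theorem decode_eq_of_mem_support (M : BlockMDP H S X A) (π : Policy H X A)
    {τ : Fin H → Step S X A} (hτ : τ ∈ (M.trajLaw π).support) (h : Fin H) :
    M.decode (τ h).2.1 = (τ h).1 := by
  rw [PMF.mem_support_iff, trajLaw_apply] at hτ
  have := Finset.prod_ne_zero_iff.1 (left_ne_zero_of_mul (right_ne_zero_of_mul hτ)) h
    (Finset.mem_univ h)
  exact M.decode_emit h _ _ ((PMF.mem_support_iff _ _).2 this)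

/-- `centered` at `s` is the visitation mass of `s` times `labelMean - v`, and a square of a number
in `[-1, 1]` is at most its absolute value. -/
theorem expect_visit_sq_le (M : BlockMDP H S X A) (π : Policy H X A) (L : Label H X A)
    (h : Fin H) {v : ℝ} (hv : 0 ≤ v ∧ v ≤ 1) :
    (expect (M.visit π h) fun s => (v - M.labelMean π L h s) ^ 2) ≤
      ∑ s, |M.centered π L h v s| := by
  refine Finset.sum_le_sum fun s _ => ?_
  have hf := M.labelMean_mem π L h s
  have hd : ((M.visit π h) s).toReal =
      expect (M.trajLaw π) fun τ => if M.decode (τ h).2.1 = s then 1 else 0 := by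
    rw [← expect_ite_eq, visit, expect_map]
    exact expect_congr _ fun τ hτ => by rw [M.decode_eq_of_mem_support π hτ]
  have hc : M.centered π L h v s =
      (expect (M.trajLaw π) fun τ =>
        if M.decode (τ h).2.1 = s then (L (fun g => (τ g).2) : ℝ) else 0) -
        ((M.visit π h) s).toReal * v := by
    rw [hd, ← expect_mul_const, ← expect_sub]
    refine expect_congr _ fun τ hτ => ?_
    rw [M.decode_eq_of_mem_support π hτ]
    split_ifs <;> simp
  by_cases h0 : ((M.visit π h) s).toReal = 0
  · rw [h0, zero_mul]
    exact abs_nonneg _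
  · have hn : (expect (M.trajLaw π) fun τ =>
        if M.decode (τ h).2.1 = s then (L (fun g => (τ g).2) : ℝ) else 0) =
        ((M.visit π h) s).toReal * M.labelMean π L h s := by
      rw [labelMean, ← hd, mul_div_cancel₀ _ h0]
    rw [hc, hn, ← mul_sub, abs_mul, abs_of_nonneg ENNReal.toReal_nonneg]
    refine mul_le_mul_of_nonneg_left ?_ ENNReal.toReal_nonneg
    dsimp only
    rw [← sq_abs, abs_sub_comm v]
    have : |M.labelMean π L h s - v| ≤ 1 := by
      rw [abs_le]
      constructor <;> linarith [hf.1, hf.2, hv.1, hv.2]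
    nlinarith [abs_nonneg (M.labelMean π L h s - v)]

end BlockMDP

namespace Scrambler

variable {H : ℕ} {X I J : Type} [Fintype X] [Fintype I] [DecidableEq I] [Fintype J] [AddGroup J]
  (W : Scrambler H X I J) [Nonempty I]

/-! ### Regression -/

/-- Given emissions and actions, the label is fixed and `s_h` has law `layer h` whatever the
actions: this is where open-loop indistinguishability decouples label and state. -/
theorem expect_ideal_centered [Nonempty X] (π : Policy H X (Fin 2)) (L : Label H X (Fin 2))
    (h : Fin H) (v : ℝ) (s : LockState H) :
    (expect (W.ideal π) fun τ =>
      ((L fun g => (τ g).2 : unitInterval) - v) * if (τ h).1 = s then 1 else 0) =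
    ((expect (W.ideal π) fun τ => (L fun g => (τ g).2 : unitInterval)) - v) *
      (W.layer h s).toReal := by
  have e1 : ((expect (W.ideal π) fun τ => (L fun g => (τ g).2 : unitInterval)) - v) =
      expect (W.ideal π) fun τ => ((L fun g => (τ g).2 : unitInterval) - v) := by
    rw [expect_sub, expect_const]
  rw [e1]
  simp only [ideal, expect_bind, expect_map, ← expect_mul_const]
  refine congrArg _ (funext fun x => congrArg _ (funext fun a => ?_))
  rw [expect_const, ← expect_ite_eq, ← W.expect_latent a h fun t => if t = s then 1 else 0]
  simp only [mul_comm ((L _ : ℝ) - v), expect_mul_const]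

theorem abs_centered_integrand_le (L : Label H X (Fin 2)) (h : Fin H) {v : ℝ}
    (hv : 0 ≤ v ∧ v ≤ 1) (s : LockState H) (τ : Traj H X) :
    |((L fun g => (τ g).2 : unitInterval) - v) * if (τ h).1 = s then (1 : ℝ) else 0| ≤ 1 := by
  have hL := (L fun g => (τ g).2).2
  split_ifs
  · rw [mul_one, abs_le]
    constructor <;> linarith [hL.1, hL.2, hv.1, hv.2]
  · simp

theorem abs_sum_centered_le [Nonempty X] {E : Finset (I → J)} {T : Finset I}
    (hE : Determined E T) (π : Policy H X (Fin 2)) (L : Label H X (Fin 2)) (h : Fin H) {v : ℝ}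
    (hv : 0 ≤ v ∧ v ≤ 1) (s : LockState H) :
    |∑ θ ∈ E, (W.mdp θ).centered π L h v s| ≤
      (|(expect (W.ideal π) fun τ => (L fun g => (τ g).2 : unitInterval)) - v| +
        2 * defect H (Fintype.card I) T.card) * E.card := by
  have key := W.abs_sum_expect_sub_le hE π fun τ => abs_centered_integrand_le L h hv s τ
  rw [expect_ideal_centered] at key
  set u := (expect (W.ideal π) fun τ => (L fun g => (τ g).2 : unitInterval)) - v
  have hl : |u * (W.layer h s).toReal| ≤ |u| := by
    rw [abs_mul, abs_of_nonneg ENNReal.toReal_nonneg]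
    exact mul_le_of_le_one_right (abs_nonneg _)
      (ENNReal.toReal_le_of_le_ofReal zero_le_one (by simpa using PMF.coe_le_one _ _))
  have hb : |(E.card : ℝ) * (u * (W.layer h s).toReal)| ≤ |u| * E.card := by
    rw [abs_mul, abs_of_nonneg (Nat.cast_nonneg _), mul_comm]
    exact mul_le_mul_of_nonneg_right hl (Nat.cast_nonneg _)
  have := abs_sub_abs_le_abs_sub (∑ θ ∈ E, (W.mdp θ).centered π L h v s)
    ((E.card : ℝ) * (u * (W.layer h s).toReal))
  have := this.trans key
  rw [add_mul]
  linarith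

/-- One factor of the square is expanded over a trajectory `τ`. Given `τ`, its integrand is a
constant of size at most 1, and the other factor is averaged over the consistent shifts by the
first-moment bound, at the price of `H` more revealed blocks. -/
theorem sum_centered_sq_le [Nonempty X] {E : Finset (I → J)} {T : Finset I}
    (hE : Determined E T) (π : Policy H X (Fin 2)) (L : Label H X (Fin 2)) (h : Fin H) {v : ℝ}
    (hv : 0 ≤ v ∧ v ≤ 1) (s : LockState H) :
    ∑ θ ∈ E, (W.mdp θ).centered π L h v s ^ 2 ≤
      (|(expect (W.ideal π) fun τ => (L fun g => (τ g).2 : unitInterval)) - v| +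
        2 * defect H (Fintype.card I) (T.card + H)) * E.card := by
  have sq : ∀ θ, (W.mdp θ).centered π L h v s ^ 2 = expect ((W.mdp θ).trajLaw π) fun τ =>
      (((L fun g => (τ g).2 : unitInterval) - v) * if (τ h).1 = s then (1 : ℝ) else 0) *
        (W.mdp θ).centered π L h v s := by
    intro θ
    rw [expect_mul_const, pow_two]
    rfl
  simp only [sq]
  refine W.sum_expect_le_of_match π fun τ => ?_
  rw [← Finset.mul_sum]
  refine (le_abs_self _).trans ?_
  rw [abs_mul]
  refine (mul_le_of_le_one_left (abs_nonneg _) (abs_centered_integrand_le L h hv s τ)).trans ?_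
  refine (W.abs_sum_centered_le (W.determined_filter_match hE τ) π L h hv s).trans ?_
  gcongr
  exact defect_mono (W.card_union_block_le T τ)

theorem sum_abs_centered_le [Nonempty X] {E : Finset (I → J)} {T : Finset I}
    (hE : Determined E T) (π : Policy H X (Fin 2)) (L : Label H X (Fin 2)) (h : Fin H) {v : ℝ}
    (hv : 0 ≤ v ∧ v ≤ 1) {α : ℝ} (hα : 0 < α)
    (hB : |(expect (W.ideal π) fun τ => (L fun g => (τ g).2 : unitInterval)) - v| +
        2 * defect H (Fintype.card I) (T.card + H) ≤ α ^ 2) :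
    ∑ θ ∈ E, ∑ s, |(W.mdp θ).centered π L h v s| ≤
      Fintype.card (LockState H) * (α * E.card) := by
  rw [Finset.sum_comm]
  have : ∀ s, ∑ θ ∈ E, |(W.mdp θ).centered π L h v s| ≤ α * E.card := by
    intro s
    -- From `(|z| - α) ^ 2 ≥ 0`; this turns the second-moment bound into a bound on the mean of
    -- `|z|`.
    have h1 : ∀ θ, |(W.mdp θ).centered π L h v s| ≤
        (W.mdp θ).centered π L h v s ^ 2 / (2 * α) + α / 2 := by
      intro θ
      rw [← sq_abs, div_add' _ _ _ (by positivity), le_div_iff₀ (by positivity)]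
      nlinarith [sq_nonneg (|(W.mdp θ).centered π L h v s| - α)]
    refine (Finset.sum_le_sum fun θ _ => h1 θ).trans ?_
    rw [Finset.sum_add_distrib, ← Finset.sum_div, Finset.sum_const, nsmul_eq_mul]
    have h2 := (W.sum_centered_sq_le hE π L h hv s).trans
      (mul_le_mul_of_nonneg_right hB (Nat.cast_nonneg _))
    have h3 := div_le_div_of_nonneg_right h2 (by positivity : 0 ≤ 2 * α)
    have h4 : α ^ 2 * (E.card : ℝ) / (2 * α) = α / 2 * E.card := by
      field_simp
    linarith
  refine (Finset.sum_le_sum fun s _ => this s).trans ?_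
  simp

/-- The value the ideal law predicts for the label, as a constant predictor. -/
def guess [Nonempty X] (b : ℕ) (π : Policy H X (Fin 2)) (L : Label H X (Fin 2)) : Predictor X :=
  Predictor.round b fun _ => expect (W.ideal π) fun τ => (L fun g => (τ g).2 : unitInterval)

/-- The constant guess is not accurate. -/
def IsBad [Nonempty X] (b : ℕ) (ε : ℝ) (θ : I → J) (π : Policy H X (Fin 2))
    (L : Label H X (Fin 2)) (h : Fin H) : Prop :=
  ¬ (W.guess b π L).IsAccurate ((W.mdp θ).emit h) ((W.mdp θ).visit π h)
    ((W.mdp θ).labelMean π L h) ε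

open Classical in
-- Markov's inequality: a bad shift makes the sum of the `|centered|` exceed `ε`. The term `(1 / 2)
-- ^ b` is the rounding error of the guess.
theorem sum_isBad_le [Nonempty X] {E : Finset (I → J)} {T : Finset I}
    (hE : Determined E T) (b : ℕ) {ε : ℝ} (hε : 0 < ε) (π : Policy H X (Fin 2))
    (L : Label H X (Fin 2)) (h : Fin H) {α : ℝ} (hα : 0 < α)
    (hB : (1 / 2) ^ b + 2 * defect H (Fintype.card I) (T.card + H) ≤ α ^ 2) :
    ∑ θ ∈ E, (if W.IsBad b ε θ π L h then 1 else 0 : ℝ) ≤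
      Fintype.card (LockState H) * α / ε * E.card := by
  obtain ⟨x₀⟩ := ‹Nonempty X›
  set c := expect (W.ideal π) fun τ => (L fun g => (τ g).2 : unitInterval) with hc
  have c0 : 0 ≤ c := expect_nonneg _ fun τ => (L _).2.1
  have c1 : c ≤ 1 := (expect_mono _ fun τ _ => (L _).2.2).trans (expect_const _ _).le
  have hv := Predictor.round_mem b (fun _ => c) x₀
  have hr := Predictor.abs_round_sub_le b (f := fun _ => c) (x := x₀) c0 c1
  set v := (Predictor.round b fun _ : X => c).eval x₀ with hv'
  have main := W.sum_abs_centered_le hE π L h hv hα (by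
    rw [abs_sub_comm]
    exact (add_le_add_left hr _).trans hB)
  have pt : ∀ θ, (if W.IsBad b ε θ π L h then 1 else 0 : ℝ) ≤
      (∑ s, |(W.mdp θ).centered π L h v s|) / ε := by
    intro θ
    split_ifs with hbad
    · rw [le_div_iff₀ hε, one_mul]
      by_contra! hlt
      refine hbad (Predictor.isAccurate_of_sq_le ?_)
      refine le_trans ?_ (((W.mdp θ).expect_visit_sq_le π L h hv).trans hlt.le)
      exact expect_mono _ fun s _ =>
        (expect_const ((W.mdp θ).emit h s) ((v - (W.mdp θ).labelMean π L h s) ^ 2)).le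
    · positivity
  refine (Finset.sum_le_sum fun θ _ => pt θ).trans ?_
  rw [← Finset.sum_div, div_mul_eq_mul_div, mul_assoc]
  exact div_le_div_of_nonneg_right main hε.le

open Classical in
/-- The oracle that gives the constant guess wherever this is accurate. -/
def oracle [Nonempty X] (b : ℕ) {ε : ℝ} (hε : 0 < ε) (θ : I → J) : RegOracle H X (Fin 2) :=
  fun _ π L h => if W.IsBad b ε θ π L h then ((W.mdp θ).exists_isAccurate hε π L h).choose
    else W.guess b π L

theorem oracle_isAccurate [Nonempty X] (b : ℕ) {ε : ℝ} (hε : 0 < ε) (θ : I → J) :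
    (W.oracle b hε θ).IsAccurate (W.mdp θ) ε := by
  intro t π L h
  rw [oracle]
  split_ifs with hb
  · exact ((W.mdp θ).exists_isAccurate hε π L h).choose_spec
  · exact not_not.1 hb

/-! ### Values -/

theorem sum_value_le [Nonempty X] {E : Finset (I → J)} {T : Finset I}
    (hE : Determined E T) (π : Policy H X (Fin 2)) :
    ∑ θ ∈ E, (W.mdp θ).value π ≤ H * defect H (Fintype.card I) T.card * E.card := by
  refine W.sum_expect_le hE π (Nat.cast_nonneg H) (fun τ => ?_) fun τ hτ => ?_
  · refine (Finset.sum_le_sum (g := fun _ => (1 : ℝ)) fun h _ => ?_).trans (by simp)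
    split_ifs <;> norm_num
  · simp [hτ.obs_reward]

/-- The policy that plays the action named by the latent state. -/
def unlock (θ : I → J) : Policy H X (Fin 2) :=
  fun _ _ x => PMF.pure (if ∃ g, W.decode θ x = some (g, (1 : Fin 2).castSucc) then 1 else 0)

/-- By induction on the step: emissions on the support decode correctly, so the policy names the
current live state and stays on a live branch. -/
theorem unlock_states (θ : I → J) {τ : Traj H X}
    (hτ : τ ∈ ((W.mdp θ).trajLaw (W.unlock θ)).support) (h : Fin H) :
    ∃ c : Fin 2, (τ h).1 = some (h, c.castSucc) := by
  have hdec := (W.mdp θ).decode_eq_of_mem_support _ hτ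
  rw [PMF.mem_support_iff, BlockMDP.trajLaw_apply, BlockMDP.latentLaw, seqLaw_apply] at hτ
  have hs := fun g => Finset.prod_ne_zero_iff.1 (left_ne_zero_of_mul hτ) g (Finset.mem_univ g)
  have ha := left_ne_zero_of_mul (right_ne_zero_of_mul (right_ne_zero_of_mul hτ))
  rw [actionLaw, seqLaw_apply] at ha
  have ha := fun g => Finset.prod_ne_zero_iff.1 ha g (Finset.mem_univ g)
  obtain ⟨h, hh⟩ := h
  induction h with
  | zero =>
    obtain ⟨c, -, hc⟩ := (PMF.mem_support_map_iff _ _ _).1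
      ((PMF.mem_support_iff _ _).2 (hs ⟨0, hh⟩))
    exact ⟨c, hc.symm⟩
  | succ k ih =>
    have hk := Nat.lt_of_succ_lt hh
    obtain ⟨c, hc⟩ := ih hk
    have act : (τ ⟨k, hk⟩).2.2.1 = c := by
      have h1 := (PMF.mem_support_iff _ _).2 (ha ⟨k, hk⟩)
      rw [unlock, PMF.mem_support_pure_iff] at h1
      rw [h1]
      have h2 : W.decode θ (τ ⟨k, hk⟩).2.1 = some (⟨k, hk⟩, c.castSucc) := (hdec _).trans hc
      dsimp only
      rw [h2]
      fin_cases c <;> simp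
    have h1 : lockTrans H (τ ⟨k, hk⟩).1 (τ ⟨k, hk⟩).2.2.1 (τ ⟨k + 1, hh⟩).1 ≠ 0 := hs ⟨k + 1, hh⟩
    rw [hc, act, lockTrans, dif_pos hh, if_pos rfl] at h1
    obtain ⟨c', -, hc'⟩ := (PMF.mem_support_map_iff _ _ _).1 ((PMF.mem_support_iff _ _).2 h1)
    exact ⟨c', hc'.symm⟩

theorem one_le_value_unlock (θ : I → J) : 1 ≤ (W.mdp θ).value (W.unlock θ) := by
  rw [BlockMDP.value]
  refine (expect_const _ _).symm.le.trans (expect_mono _ fun τ hτ => ?_)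
  let h : Fin H := ⟨H - 1, Nat.sub_lt W.H_pos one_pos⟩
  have hr : (τ h).2.2.2 = true := by
    obtain ⟨c, hc⟩ := W.unlock_states θ hτ h
    rw [PMF.mem_support_iff, BlockMDP.trajLaw_apply] at hτ
    have := Finset.prod_ne_zero_iff.1
      (right_ne_zero_of_mul (right_ne_zero_of_mul (right_ne_zero_of_mul hτ))) h (Finset.mem_univ h)
    have h1 : coin (lockReward H (τ h).1) (τ h).2.2.2 ≠ 0 := this
    have hH : (h : ℕ) + 1 = H := Nat.sub_add_cancel W.H_pos
    rw [hc, lockReward, if_pos ⟨hH, (Fin.castSucc_lt_last c).ne⟩] at h1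
    by_contra hf
    rw [Bool.not_eq_true] at hf
    rw [hf] at h1
    simp [coin] at h1
  have := Finset.single_le_sum (f := fun h => if (τ h).2.2.2 then (1 : ℝ) else 0)
    (fun h _ => by split_ifs <;> norm_num) (Finset.mem_univ h)
  simpa only [hr, if_true] using this

open Classical in
-- Since `unlock` has value at least 1, a `1 / 2`-suboptimal policy has value at least `1 / 2`; then
-- Markov's inequality.
theorem sum_suboptimal_le [Nonempty X] {E : Finset (I → J)} {T : Finset I}
    (hE : Determined E T) (π : Policy H X (Fin 2)) :
    ∑ θ ∈ E, (if (W.mdp θ).Suboptimal (1 / 2) π then 1 else 0 : ℝ) ≤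
      2 * (H * defect H (Fintype.card I) T.card) * E.card := by
  have pt : ∀ θ, (if (W.mdp θ).Suboptimal (1 / 2) π then 1 else 0 : ℝ) ≤
      2 * (W.mdp θ).value π := by
    intro θ
    split_ifs with hs
    · have := hs (W.unlock θ)
      linarith [W.one_le_value_unlock θ]
    · refine mul_nonneg zero_le_two (expect_nonneg _ fun τ => Finset.sum_nonneg fun h _ => ?_)
      split_ifs <;> norm_num
  refine (Finset.sum_le_sum fun θ _ => pt θ).trans ?_
  rw [← Finset.mul_sum, mul_assoc]
  exact mul_le_mul_of_nonneg_left (W.sum_value_le hE π) zero_le_two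

end Scrambler

theorem sum_ite_le_ofReal_mul_card {ι : Type} (E : Finset ι) (p : ι → Prop) [DecidablePred p]
    {B : ℝ} (hB : 0 ≤ B) (h : ∑ θ ∈ E, (if p θ then 1 else 0 : ℝ) ≤ B * E.card) :
    ∑ θ ∈ E, (if p θ then 1 else 0 : ℝ≥0∞) ≤ ENNReal.ofReal B * E.card := by
  rw [Finset.sum_boole] at h ⊢
  rw [← ENNReal.ofReal_natCast, ← ENNReal.ofReal_natCast, ← ENNReal.ofReal_mul hB]
  exact ENNReal.ofReal_le_ofReal h

namespace Scrambler

variable {H : ℕ} {X I J : Type} [Fintype X] [Fintype I] [DecidableEq I] [Fintype J] [AddGroup J]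
  (W : Scrambler H X I J) [Nonempty I]

/-! ### The lower bound -/

open Classical in
theorem half_le [Nonempty X] (alg : OracleAlg H X (Fin 2)) (k b : ℕ) {ε α : ℝ} (hε : 0 < ε)
    (hα : 0 < α)
    (hB : (1 / 2) ^ b + 2 * defect H (Fintype.card I) (k * H + H) ≤ α ^ 2)
    (halg : ∀ θ, ∀ O : RegOracle H X (Fin 2), O.IsAccurate (W.mdp θ) ε →
      (1 / 2 : ℝ≥0∞) ≤ (run (W.mdp θ) O alg k []).toOuterMeasure
        {out | ∃ π, out = some π ∧ (W.mdp θ).Suboptimal (1 / 2) π}) :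
    1 / 2 ≤ 2 * (H * defect H (Fintype.card I) (k * H)) +
      k * (Fintype.card (LockState H) * α / ε) := by
  have hβ : 0 ≤ 2 * (H * defect H (Fintype.card I) (k * H)) := by
    have := defect_nonneg H (Fintype.card I) (k * H)
    positivity
  have hγ : 0 ≤ Fintype.card (LockState H) * α / ε := by positivity
  have key := W.sum_run_le alg (W.oracle b hε) (fun π L _ => W.guess b π L)
    (fun θ π => (W.mdp θ).Suboptimal (1 / 2) π) (W.IsBad b ε)
    (fun θ t π L h hb => if_neg hb) (N := k * H)
    (β := ENNReal.ofReal (2 * (H * defect H (Fintype.card I) (k * H))))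
    (γ := ENNReal.ofReal (Fintype.card (LockState H) * α / ε))
    (fun E T hE hT π => sum_ite_le_ofReal_mul_card E _ hβ
      ((W.sum_suboptimal_le hE π).trans (by
        have := defect_mono (H := H) (N := Fintype.card I) hT
        gcongr)))
    (fun E T hE hT π L h => sum_ite_le_ofReal_mul_card E _ hγ
      (W.sum_isBad_le hE b hε π L h hα (le_trans (by
        have := defect_mono (H := H) (N := Fintype.card I) (Nat.add_le_add_right hT H)
        gcongr) hB)))
    -- Initially nothing is revealed: all shifts are possible and `T` is empty.
    k [] Finset.univ ∅ (fun _ _ _ _ => Finset.mem_univ _) (by simp)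
  have low := Finset.sum_le_sum fun θ (_ : θ ∈ (Finset.univ : Finset (I → J))) =>
    halg θ (W.oracle b hε θ) (W.oracle_isAccurate b hε θ)
  have both := low.trans key
  rw [Finset.sum_const, nsmul_eq_mul, mul_comm, ENNReal.mul_le_mul_iff_left (by simp) (by simp),
    ← ENNReal.ofReal_natCast k, ← ENNReal.ofReal_mul (Nat.cast_nonneg k),
    ← ENNReal.ofReal_add hβ (by positivity)] at both
  have half : (1 / 2 : ℝ≥0∞) = ENNReal.ofReal (1 / 2) := by
    rw [ENNReal.ofReal_div_of_pos two_pos]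
    simp
  rw [half] at both
  exact (ENNReal.ofReal_le_ofReal_iff (by positivity)).1 both

end Scrambler

/-! ### Choice of parameters. -/

open Scrambler

/-- It yields `80 * n ≤ 2 ^ (n / 4)`, which absorbs the factors of `n` below. The induction step
rests on `(7 / 6) ^ 4 < 2`. -/
theorem pow_four_le_two_pow {n : ℕ} (hn : 48 ≤ n) : (80 * n) ^ 4 ≤ 2 ^ n := by
  induction n, hn using Nat.le_induction with
  | base => norm_num
  | succ n hn ih =>
    have : 6 * (80 * (n + 1)) ≤ 7 * (80 * n) := by omega
    have h4 := Nat.pow_le_pow_left this 4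
    rw [mul_pow, mul_pow 7] at h4
    rw [pow_succ 2]
    omega

theorem exists_scrambler {n : ℕ} (hn : 48 ≤ n) :
    Nonempty (Scrambler n (Fin (5 * n) → Bool) (Fin (2 ^ (4 * n))) (ZMod (2 ^ n))) := by
  have hc : Fintype.card (LockState n) ≤ Fintype.card (ZMod (2 ^ n)) := by
    rw [ZMod.card]
    have h1 := pow_four_le_two_pow hn
    have h2 : 80 * n ≤ (80 * n) ^ 4 := Nat.le_self_pow (by norm_num) _
    simp only [LockState, Fintype.card_option, Fintype.card_prod, Fintype.card_fin]
    omega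
  obtain ⟨f⟩ := Function.Embedding.nonempty_of_card_le hc
  refine ⟨⟨Fintype.equivOfCardEq ?_, Function.invFun f, Function.invFun_surjective f.injective,
    by omega⟩⟩
  simp only [Fintype.card_prod, Fintype.card_fin, ZMod.card, Fintype.card_fun, Fintype.card_bool]
  rw [← pow_add]
  congr 1
  omega

theorem defect_le {n k : ℕ} (hn : 48 ≤ n) (hk : k ≤ 2 ^ n) :
    defect n (2 ^ (4 * n)) (k * n + n) ≤ 4 * (1 / 2) ^ n := by
  have h1 : n ^ 2 ≤ 2 ^ n := by
    refine le_trans ?_ (pow_four_le_two_pow hn)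
    calc n ^ 2 ≤ (80 * n) ^ 2 := Nat.pow_le_pow_left (by omega) 2
      _ ≤ (80 * n) ^ 4 := Nat.pow_le_pow_right (by omega) (by norm_num)
  have h2 : 2 ≤ 2 ^ n := Nat.le_self_pow (by omega) 2
  have h3 : n * (k * n + n) + n ^ 2 ≤ 2 ^ n * (2 * 2 ^ n) := by
    calc n * (k * n + n) + n ^ 2 = n ^ 2 * (k + 2) := by ring
      _ ≤ 2 ^ n * (2 * 2 ^ n) := Nat.mul_le_mul h1 (by omega)
  have h3' : ((n : ℝ) * (k * n + n) + n ^ 2) ≤ 2 ^ n * (2 * 2 ^ n) := by exact_mod_cast h3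
  have hp : (1 : ℝ) ≤ 2 ^ n := one_le_pow₀ (by norm_num)
  have h4 : ((n : ℝ) * (k * n + n) + n ^ 2) / 2 ^ (4 * n) ≤ 2 * (1 / 2) ^ n := by
    rw [div_le_iff₀ (by positivity), one_div, inv_pow, mul_comm 4 n, pow_mul]
    refine h3'.trans ?_
    have : (2 : ℝ) * (2 ^ n)⁻¹ * (2 ^ n) ^ 4 = 2 * (2 ^ n) ^ 3 := by
      field_simp
    rw [this]
    nlinarith [mul_nonneg (sub_nonneg.2 hp) (sq_nonneg ((2 : ℝ) ^ n))]
  unfold defect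
  push_cast
  linarith

theorem le_or_le_of_reduction {n : ℕ} (hn : 48 ≤ n) (hn0 : 0 < n) {k : ℕ} {ε : ℝ} (hε : 0 < ε)
    (alg : OracleAlg n (Fin (5 * n) → Bool) (Fin 2))
    (halg : ∀ (φ : (Fin (5 * n) → Bool) → LockState n) (hφ : Function.Surjective φ),
      ∀ O : RegOracle n (Fin (5 * n) → Bool) (Fin 2), O.IsAccurate (lockMDP n hn0 φ hφ) ε →
      (1 / 2 : ℝ≥0∞) ≤ (run (lockMDP n hn0 φ hφ) O alg k []).toOuterMeasure
        {out | ∃ π, out = some π ∧ (lockMDP n hn0 φ hφ).Suboptimal (1 / 2) π}) :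
    ε ≤ (2 : ℝ) ^ (-(n : ℝ) / 8) ∨ (2 : ℝ) ^ ((n : ℝ) / 8) ≤ k := by
  by_contra! hcon
  obtain ⟨hε', hk⟩ := hcon
  obtain ⟨W⟩ := exists_scrambler hn
  -- In terms of `y`: `2 ^ n = y ^ 8`, `80 * n ≤ y ^ 2`, and the negated conclusion says `1 / ε < y`
  -- and `k < y`.
  set y : ℝ := (2 : ℝ) ^ ((n : ℝ) / 8) with hy
  have hy1 : 1 ≤ y := Real.one_le_rpow (by norm_num) (by positivity)
  have hy0 : 0 < y := by positivity
  have hyinv : (2 : ℝ) ^ (-(n : ℝ) / 8) = y⁻¹ := by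
    rw [hy, ← Real.rpow_neg (by norm_num), neg_div]
  have hy8 : y ^ 8 = 2 ^ n := by
    rw [hy, ← Real.rpow_natCast, ← Real.rpow_mul (by norm_num), ← Real.rpow_natCast]
    congr 1
    push_cast
    ring
  have hhalf : ((1 : ℝ) / 2) ^ n = (y ^ 8)⁻¹ := by rw [hy8, one_div, inv_pow]
  have hn80 : 80 * (n : ℝ) ≤ y ^ 2 := by
    have h1 : (80 * (n : ℝ)) ^ 4 ≤ (y ^ 2) ^ 4 := by
      rw [← pow_mul, hy8]
      exact_mod_cast pow_four_le_two_pow hn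
    exact le_of_pow_le_pow_left₀ (by norm_num) (by positivity) h1
  have hk' : k ≤ 2 ^ n := by
    have : (k : ℝ) ≤ 2 ^ n := by
      rw [← hy8]
      exact hk.le.trans (le_self_pow₀ hy1 (by norm_num))
    exact_mod_cast this
  have hD := defect_le hn hk'
  rw [hhalf] at hD
  have hcI : Fintype.card (Fin (2 ^ (4 * n))) = 2 ^ (4 * n) := Fintype.card_fin _
  -- With `b = n`, rounding costs `y ^ (-8)` and twice the defect at most `8 * y ^ (-8)`, together
  -- `9 * y ^ (-8)`, the square of `3 * y ^ (-4)`.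
  have main := W.half_le alg k n hε (α := 3 * (y ^ 4)⁻¹) (by positivity) (by
      rw [hcI, hhalf]
      have : (3 * (y ^ 4)⁻¹) ^ 2 = 9 * (y ^ 8)⁻¹ := by
        rw [mul_pow, inv_pow, ← pow_mul]
        norm_num
      rw [this]
      linarith) fun θ O hO => halg _ (W.decode_surj θ) O hO
  rw [hcI] at main
  have hD' : defect n (2 ^ (4 * n)) (k * n) ≤ 4 * (y ^ 8)⁻¹ :=
    (defect_mono (Nat.le_add_right _ _)).trans hD
  have hy2 : 0 < y ^ 2 := by positivity
  have hnR : (48 : ℝ) ≤ n := by exact_mod_cast hn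
  have b1 : 2 * ((n : ℝ) * defect n (2 ^ (4 * n)) (k * n)) ≤ 1 / 10 := by
    have e1 : (y ^ 8)⁻¹ ≤ (y ^ 2)⁻¹ :=
      inv_anti₀ hy2 (pow_le_pow_right₀ hy1 (by norm_num))
    have e2 : (n : ℝ) * (y ^ 2)⁻¹ ≤ 1 / 80 := by
      rw [← div_eq_mul_inv, div_le_iff₀ hy2]
      linarith
    have e3 : (n : ℝ) * defect n (2 ^ (4 * n)) (k * n) ≤ n * (4 * (y ^ 2)⁻¹) := by
      gcongr
      linarith
    linarith
  have b2 : (k : ℝ) * (Fintype.card (LockState n) * (3 * (y ^ 4)⁻¹) / ε) ≤ 1 / 5 := by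
    have hS : (Fintype.card (LockState n) : ℝ) ≤ 4 * n := by
      have : Fintype.card (LockState n) ≤ 4 * n := by
        simp only [LockState, Fintype.card_option, Fintype.card_prod, Fintype.card_fin]
        omega
      exact_mod_cast this
    have hεy : 1 / ε ≤ y := by
      rw [hyinv] at hε'
      rw [one_div]
      exact inv_le_of_inv_le₀ hy0 hε'.le
    calc (k : ℝ) * (Fintype.card (LockState n) * (3 * (y ^ 4)⁻¹) / ε)
        = k * (Fintype.card (LockState n) * (3 * (y ^ 4)⁻¹) * (1 / ε)) := by ring
      _ ≤ y * (4 * n * (3 * (y ^ 4)⁻¹) * y) := by gcongr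
      _ = 12 * n / y ^ 2 := by
        field_simp
        norm_num
      _ ≤ 1 / 5 := by
        rw [div_le_iff₀ hy2]
        linarith
  -- Contradiction: `1 / 2 ≤ 1 / 10 + 1 / 5`.
  linarith

end BlockRL

end

theorem theorem9p1 :
    ∃ (K : ℕ) (C : ℝ) (C' : ℕ), 0 < C ∧
      (∀ n : ℕ+, max (max (Fintype.card (BlockRL.lockFamily.S n))
          (Fintype.card (BlockRL.lockFamily.A n))) (BlockRL.lockFamily.len n) ≤
            K * BlockRL.lockFamily.H n) ∧
      (∀ n : ℕ+, ∀ M ∈ BlockRL.lockFamily.mdps n, M.OpenLoopIndist) ∧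
      ∀ (T : ℕ+ → ℕ) (ε : ℕ+ → ℝ), (∀ n, 0 < ε n ∧ ε n < 1) →
        ∀ alg : (∀ n : ℕ+, BlockRL.OracleAlg (BlockRL.lockFamily.H n)
            (BlockRL.lockFamily.X n) (BlockRL.lockFamily.A n)),
          BlockRL.IsReduction BlockRL.lockFamily T ε alg →
          ∀ n : ℕ+, C' ≤ (n : ℕ) →
            ε n ≤ C * (2 : ℝ) ^ (-(BlockRL.lockFamily.H n : ℝ) / 8) ∨
            C⁻¹ * (2 : ℝ) ^ ((BlockRL.lockFamily.H n : ℝ) / 8) ≤ (T n : ℝ) := by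
  -- The 5 is forced by the emission length `5 * n`, and also covers the `3 * n + 1` latent states.
  refine ⟨5, 1, 48, one_pos, fun n => ?_, fun n M hM => ?_, fun T ε hε alg hred n hn => ?_⟩
  · have hS : Fintype.card (BlockRL.lockFamily.S n) = (n : ℕ) * 3 + 1 :=
      (Fintype.card_option (α := Fin n × Fin 3)).trans (by simp)
    have hA : Fintype.card (BlockRL.lockFamily.A n) = 2 := Fintype.card_fin 2
    have hlen : BlockRL.lockFamily.len n = 5 * n := rfl
    have hH : BlockRL.lockFamily.H n = n := rfl
    have := n.pos
    rw [hS, hA, hlen, hH]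
    omega
  · obtain ⟨φ, hφ, rfl⟩ := hM
    exact BlockRL.openLoopIndist_lockMDP n.pos φ hφ
  · rw [inv_one, one_mul, one_mul]
    exact BlockRL.le_or_le_of_reduction hn n.pos (hε n).1 (alg n) fun φ hφ O hO =>
      (hred n _ ⟨φ, hφ, rfl⟩ O hO).2
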